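/- For $\theta>0$ let $f(x\mid\theta)=\frac1\theta e^{-x/\theta}$ for $x>0$ (and $0$ otherwise), with parameter space $\Theta=(0,\infty)$. Let $n\ge 1$, $\theta_0>0$, let $X_1,\dots,X_n$ be i.i.d. with density $f(\cdot\mid\theta_0)$ (exponential with mean $\theta_0$), $\boldsymbol X=(X_1,\dots,X_n)$, $\bar X=\frac1n\sum_i X_i$, $L(\theta;\boldsymbol x)=\prod_{i=1}^n f(x_i\mid\theta)$ and $\ell=\log L$; $\mathbb E_\theta$ denotes expectation when the data have density $f(\cdot\mid\theta)$. (i) For every $\boldsymbol x\in(0,\infty)^n$ (hence almost surely for $\boldsymbol x=\boldsymbol X$) the maximiser of $L(\cdot\,;\boldsymbol x)$ over $\Theta$ exists, is unique, and equals the sample mean; thus $\hat\theta_n(\boldsymbol X)=\bar X$. (ii) The following regularity conditions hold. (R.C.1) Different $\theta$ give different densities. (R.C.2) $\Theta$ is open and $\ell(\cdot\,;\boldsymbol x)$ is three times continuously differentiable on $\Theta$ for every $\boldsymbol x\in(0,\infty)^n$. (R.C.3) For every $\theta_0\in\Theta$ there are $\epsilon(\theta_0)>0$ and a function $M$ with $(\theta_0-\epsilon(\theta_0),\theta_0+\epsilon(\theta_0))\subseteq\Theta$,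 $|\partial_\theta^3\ell(\theta;\boldsymbol x)|\le M(\boldsymbol x)$ for all $\boldsymbol x\in(0,\infty)^n$ and $|\theta-\theta_0|<\epsilon(\theta_0)$, and $\mathbb E_{\theta_0}|M(\boldsymbol X)|<\infty$. (R.C.4) $\mathbb E_\theta[\partial_\theta\log f(X_1\mid\theta)]=0$ for all $\theta\in\Theta$. (R.C.5) For all $\theta\in\Theta$ the Fisher information $I(\theta)=\mathbb E_\theta[(\partial_\theta\log f(X_1\mid\theta))^2]$ is finite and positive, and $nI(\theta)=\mathbb E_\theta[(\partial_\theta\ell(\theta;\boldsymbol X))^2]=-\mathbb E_\theta[\partial_\theta^2\ell(\theta;\boldsymbol X)]$. (O2) For every $\theta_0\in\Theta$, $\epsilon(\theta_0)$ and $M$ can be chosen as in (R.C.3) such that moreover, for all $0<\epsilon\le\epsilon(\theta_0)$ and $\kappa\in\{2,4\}$, the event $|\bar X-\theta_0|<\epsilon$ has positive probability and $\mathbb E_{\theta_0}\big[M(\boldsymbol X)^\kappa\,\big|\,|\bar X-\theta_0|<\epsilon\big]<\infty$. (O3) For all $\theta\in\Theta$, $\partial_\theta\log f(X_1\mid\theta)$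 has finite absolute moments under $\theta$ up to order five. (iii) Let $K\sim\chi^2_1$ and let $h:\mathbb R\to\mathbb R$ be bounded and twice continuously differentiable with bounded $h',h''$; $\|\cdot\|$ is the supremum norm. Put $$\Delta=\Big|\mathbb E\big[h\big(2(\ell(\bar X;\boldsymbol X)-\ell(\theta_0;\boldsymbol X))\big)\big]-\mathbb E[h(K)]\Big|,\qquad S=\frac{\sqrt2}{\theta_0^8\sqrt\pi}\Big(19\theta_0^4+325\theta_0^2+2733+\frac{36973}n\Big),$$ $$C=6\sqrt{3+\tfrac6n}+\sqrt{15+\tfrac{130}n+\tfrac{120}{n^2}}\Big(\tfrac{1120}3+\frac{320(3+\frac6n)^{1/4}+4}{\sqrt n}\Big)+\frac{6400}{\sqrt n}\sqrt{105+\tfrac{2380}n+\tfrac{7308}{n^2}+\tfrac{5040}{n^3}}.$$ Then $$\Delta<\frac{8\|h\|}n+S+\frac{\|h'\|}{\sqrt n}\,C,$$ and, if $h$ is not identically zero, also $$\Delta<\frac{8\|h\|}n+\frac{2(\|h'\|+\|h''\|)}{\sqrt n}\,S+\frac{\|h'\|}{\sqrt n}\,C .$$ In particular the second bound is $O(n^{-1/2})$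 for fixed $\theta_0$ and $h$. -/

import Mathlib

open MeasureTheory ProbabilityTheory

/-- A statistical model with a one-dimensional parameter for real-valued observations:
the parameter space `Θ` and the probability densities `f θ` (with respect to Lebesgue measure). -/
structure ParamModel where
  Θ : Set ℝ
  f : ℝ → ℝ → ℝ

namespace ParamModel

/-- The support of one observation. -/
def support (m : ParamModel) : Set ℝ := {x | ∃ θ ∈ m.Θ, 0 < m.f θ x}

/-- The support `𝕏` of a sample of size `n`. -/
def sampleSupport (m : ParamModel) (n : ℕ) : Set (Fin n → ℝ) := {x | ∀ i, x i ∈ m.support}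

/-- The law of one observation under the parameter `θ`. -/
noncomputable def law (m : ParamModel) (θ : ℝ) : Measure ℝ :=
  volume.withDensity fun x => ENNReal.ofReal (m.f θ x)

/-- The law of an i.i.d. sample of size `n` under the parameter `θ`. -/
noncomputable def sampleLaw (m : ParamModel) (n : ℕ) (θ : ℝ) : Measure (Fin n → ℝ) :=
  Measure.pi fun _ => m.law θ

/-- The likelihood `L(θ; x) = ∏ f(x_i | θ)`. -/
noncomputable def lik (m : ParamModel) {n : ℕ} (θ : ℝ) (x : Fin n → ℝ) : ℝ := ∏ i, m.f θ (x i)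

/-- The log-likelihood `ℓ(θ; x) = log L(θ; x)`. -/
noncomputable def loglik (m : ParamModel) {n : ℕ} (θ : ℝ) (x : Fin n → ℝ) : ℝ :=
  Real.log (m.lik θ x)

/-- `θ̂` is a maximum likelihood estimate for the sample `x`: a maximiser of the likelihood
over the parameter space. -/
def IsMLE (m : ParamModel) {n : ℕ} (x : Fin n → ℝ) (θhat : ℝ) : Prop :=
  θhat ∈ m.Θ ∧ ∀ θ ∈ m.Θ, m.lik θ x ≤ m.lik θhat x

/-- The score of one observation, `∂/∂θ log f(x | θ)`. -/
noncomputable def score (m : ParamModel) (θ x : ℝ) : ℝ := deriv (fun t => Real.log (m.f t x)) θ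

/-- The expected Fisher information number of one observation. -/
noncomputable def fisherInfo (m : ParamModel) (θ : ℝ) : ℝ := ∫ x, m.score θ x ^ 2 ∂(m.law θ)

/-- (R.C.1) The densities defined by two different parameters are distinct
(as elements of `L¹`, that is, not almost everywhere equal). -/
def RC1 (m : ParamModel) : Prop :=
  ∀ θ ∈ m.Θ, ∀ θ' ∈ m.Θ, θ ≠ θ' → ¬ (m.f θ =ᵐ[volume] m.f θ')

/-- (R.C.2) The log-likelihood is three times differentiable in the parameter, with continuous
third derivative. -/
def RC2 (m : ParamModel) (n : ℕ) : Prop :=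
  IsOpen m.Θ ∧ ∀ x ∈ m.sampleSupport n, ContDiffOn ℝ 3 (fun θ => m.loglik θ x) m.Θ

/-- `ε` and `M` are as required in (R.C.3) at the parameter `θ₀`: on the `ε`-neighbourhood of `θ₀`,
which lies in the parameter space, the third derivative of the log-likelihood is bounded by `M`,
and `M` has finite expectation. -/
def ThirdDerivBound (m : ParamModel) (n : ℕ) (θ₀ ε : ℝ) (M : (Fin n → ℝ) → ℝ) : Prop :=
  0 < ε ∧
  (∀ θ, |θ - θ₀| < ε → θ ∈ m.Θ ∧
    ∀ x ∈ m.sampleSupport n, |iteratedDeriv 3 (fun t => m.loglik t x) θ| ≤ M x) ∧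
  Integrable M (m.sampleLaw n θ₀)

/-- (R.C.3) -/
def RC3 (m : ParamModel) (n : ℕ) : Prop :=
  ∀ θ₀ ∈ m.Θ, ∃ (ε : ℝ) (M : (Fin n → ℝ) → ℝ), m.ThirdDerivBound n θ₀ ε M

/-- (R.C.4) The score of an observation has expectation zero. -/
def RC4 (m : ParamModel) : Prop :=
  ∀ θ ∈ m.Θ, Integrable (m.score θ) (m.law θ) ∧ ∫ x, m.score θ x ∂(m.law θ) = 0

/-- (R.C.5) The Fisher information `I(θ)` is finite and positive, and
`n I(θ) = E_θ[(∂ℓ/∂θ)²] = - E_θ[∂²ℓ/∂θ²]`. -/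
def RC5 (m : ParamModel) (n : ℕ) : Prop :=
  ∀ θ ∈ m.Θ,
    Integrable (fun x => m.score θ x ^ 2) (m.law θ) ∧ 0 < m.fisherInfo θ ∧
    Integrable (fun x => deriv (fun t => m.loglik t x) θ ^ 2) (m.sampleLaw n θ) ∧
    n * m.fisherInfo θ = ∫ x, deriv (fun t => m.loglik t x) θ ^ 2 ∂(m.sampleLaw n θ) ∧
    Integrable (fun x => iteratedDeriv 2 (fun t => m.loglik t x) θ) (m.sampleLaw n θ) ∧
    n * m.fisherInfo θ = - ∫ x, iteratedDeriv 2 (fun t => m.loglik t x) θ ∂(m.sampleLaw n θ)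

/-- (O2) for the estimator `θhat`: `ε(θ₀)` and `M` can be chosen as in (R.C.3) such that moreover
`E[M(X)^κ | |θhat(X) - θ₀| < ε] < ∞` for all `0 < ε ≤ ε(θ₀)` and `κ = 2, 4`; the conditioning
events have positive probability. -/
def O2 (m : ParamModel) (n : ℕ) (θhat : (Fin n → ℝ) → ℝ) : Prop :=
  ∀ θ₀ ∈ m.Θ, ∃ (ε₀ : ℝ) (M : (Fin n → ℝ) → ℝ), m.ThirdDerivBound n θ₀ ε₀ M ∧
    ∀ ε, 0 < ε → ε ≤ ε₀ →
      0 < m.sampleLaw n θ₀ {x | |θhat x - θ₀| < ε} ∧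
      ∀ κ ∈ ({2, 4} : Set ℕ), Integrable (fun x => M x ^ κ)
        (ProbabilityTheory.cond (m.sampleLaw n θ₀) {x | |θhat x - θ₀| < ε})

/-- (O3) The score of an observation has finite absolute moments up to order five. -/
def O3 (m : ParamModel) : Prop :=
  ∀ θ ∈ m.Θ, ∀ k ≤ 5, Integrable (fun x => |m.score θ x| ^ k) (m.law θ)

end ParamModel

/-- The exponential model parametrised by the mean `θ > 0`:
`f(x | θ) = θ⁻¹ exp(-x / θ)` for `x > 0`. -/
noncomputable def expModel : ParamModel where
  Θ := Set.Ioi 0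
  f θ x := if 0 < x then 1 / θ * Real.exp (-(1 / θ) * x) else 0

/-- The sample mean. -/
noncomputable def sampleMean {n : ℕ} (x : Fin n → ℝ) : ℝ := (∑ i, x i) / n

/-- The chi-square distribution with `k` degrees of freedom: the law of the sum of the squares of
`k` independent standard normal random variables. -/
noncomputable def chiSquaredMeasure (k : ℕ) : Measure ℝ :=
  (Measure.pi fun _ : Fin k => gaussianReal 0 1).map fun z => ∑ i, z i ^ 2

/-- The supremum norm of a real function (meaningful for bounded functions). -/
noncomputable def supNorm (g : ℝ → ℝ) : ℝ := ⨆ x, |g x|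

/-- `h ∈ C_b²(ℝ)`: twice continuously differentiable, bounded, with bounded first and second
derivatives. -/
structure IsCb2 (h : ℝ → ℝ) : Prop where
  contDiff : ContDiff ℝ 2 h
  bdd : ∃ C, ∀ x, |h x| ≤ C
  bdd_deriv : ∃ C, ∀ x, |deriv h x| ≤ C
  bdd_deriv_two : ∃ C, ∀ x, |iteratedDeriv 2 h x| ≤ C

/-- `(√2 / (θ₀⁸ √π)) (19 θ₀⁴ + 325 θ₀² + 2733 + 36973 / n)`. -/
noncomputable def scoreTerm (θ₀ : ℝ) (n : ℕ) : ℝ :=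
  √2 / (θ₀ ^ 8 * √Real.pi) * (19 * θ₀ ^ 4 + 325 * θ₀ ^ 2 + 2733 + 36973 / n)

/-- The constant in braces that multiplies `‖h'‖ / √n`. -/
noncomputable def remainderTerm (n : ℕ) : ℝ :=
  6 * √(3 + 6 / (n : ℝ)) +
  √(15 + 130 / (n : ℝ) + 120 / (n : ℝ) ^ 2) *
    (1120 / 3 + (320 * (3 + 6 / (n : ℝ)) ^ (1 / 4 : ℝ) + 4) / √(n : ℝ)) +
  6400 / √(n : ℝ) *
    √(105 + 2380 / (n : ℝ) + 7308 / (n : ℝ) ^ 2 + 5040 / (n : ℝ) ^ 3)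

/-!
Write `d u = exp u - 1 - u`. The likelihood ratio statistic is `2 n d(U)` with `U = log (X̄ / θ₀)`,
and since `n X̄` has a gamma law of shape `n`, the density of `U` is proportional to `exp (-n d u)`.
Let `ν` be the law on the line under which the signed square root `Z` of `2 n d` is standard
Gaussian, so that `2 n d` is exactly `χ²₁`. By the change of variables, `U` has with respect to `ν`
the density `c √(2 d u) / |exp u - 1|`, where `c ≤ 1` is the ratio of Stirling's approximation of
`n!` to `n!`. As `√(2 d u) / |exp u - 1|` differs from `1` by at most `√(2 d u) = |Z| / √n`, and
total mass one forces `1 - c ≤ 1 / √n`, the first four moments of `Z` bound the difference of the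
two expectations by `3 ‖h'‖ / √n`. The error bounds claimed are larger: their last term alone is at
least `6 √3 ‖h'‖ / √n`.
-/

section Deviance

/-- The exponential Taylor remainder `u ↦ exp u - 1 - u`. Twice its value at `log (ȳ / θ)` is the
likelihood ratio statistic, per observation, of a sample with exponential law and mean `ȳ`. -/
noncomputable def deviance (u : ℝ) : ℝ := Real.exp u - 1 - u

@[fun_prop]
lemma continuous_deviance : Continuous deviance := by
  unfold deviance
  fun_prop

@[simp]
lemma deviance_zero : deviance 0 = 0 := by simp [deviance]

lemma hasDerivAt_deviance (u : ℝ) : HasDerivAt deviance (Real.exp u - 1) u :=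
  ((Real.hasDerivAt_exp u).sub_const 1).sub (hasDerivAt_id u)

lemma deviance_nonneg (u : ℝ) : 0 ≤ deviance u := by
  have := Real.add_one_le_exp u
  unfold deviance
  linarith

lemma deviance_pos {u : ℝ} (hu : u ≠ 0) : 0 < deviance u := by
  have := Real.add_one_lt_exp hu
  unfold deviance
  linarith

lemma deviance_tangent_le (u v : ℝ) :
    deviance u + (Real.exp u - 1) * (v - u) ≤ deviance v := by
  have hv : Real.exp v = Real.exp u * Real.exp (v - u) := by
    rw [← Real.exp_add, add_sub_cancel]
  have := mul_le_mul_of_nonneg_left (Real.add_one_le_exp (v - u)) (Real.exp_pos u).le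
  unfold deviance
  linarith

lemma monotoneOn_deviance : MonotoneOn deviance (Set.Ici 0) := fun u hu v _ huv => by
  have := mul_nonneg (sub_nonneg.2 (Real.one_le_exp hu)) (sub_nonneg.2 huv)
  linarith [deviance_tangent_le u v]

lemma antitoneOn_deviance : AntitoneOn deviance (Set.Iic 0) := fun u _ v hv huv => by
  have := mul_nonneg (sub_nonneg.2 (Real.exp_le_one_iff.2 hv)) (sub_nonneg.2 huv)
  linarith [deviance_tangent_le v u]

lemma monotone_exp_sub_one_sq_sub_two_mul_deviance :
    Monotone fun u => (Real.exp u - 1) ^ 2 - 2 * deviance u := by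
  have hder (u : ℝ) : HasDerivAt (fun u => (Real.exp u - 1) ^ 2 - 2 * deviance u)
      (2 * (Real.exp u - 1) ^ 2) u := by
    refine ((((Real.hasDerivAt_exp u).sub_const 1).pow 2).sub
      ((hasDerivAt_deviance u).const_mul 2)).congr_deriv ?_
    norm_num
    ring
  exact monotone_of_hasDerivAt_nonneg hder fun u => by positivity

lemma two_mul_deviance_le_exp_sub_one_sq {u : ℝ} (hu : 0 ≤ u) :
    2 * deviance u ≤ (Real.exp u - 1) ^ 2 := by
  simpa using monotone_exp_sub_one_sq_sub_two_mul_deviance hu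

lemma exp_sub_one_sq_le_two_mul_deviance {u : ℝ} (hu : u ≤ 0) :
    (Real.exp u - 1) ^ 2 ≤ 2 * deviance u := by
  simpa using monotone_exp_sub_one_sq_sub_two_mul_deviance hu

lemma two_mul_deviance_mul_exp (u : ℝ) :
    2 * deviance u * Real.exp u =
      (Real.exp u - 1) ^ 2 + 2 * Real.exp u * (Real.sinh u - u) := by
  have : Real.exp u * Real.exp (-u) = 1 := by rw [← Real.exp_add, add_neg_cancel, Real.exp_zero]
  rw [Real.sinh_eq, deviance]
  linear_combination this

lemma exp_sub_one_sq_le_two_mul_deviance_mul_exp {u : ℝ} (hu : 0 ≤ u) :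
    (Real.exp u - 1) ^ 2 ≤ 2 * deviance u * Real.exp u := by
  have := mul_nonneg (Real.exp_pos u).le (sub_nonneg.2 (Real.self_le_sinh_iff.2 hu))
  linarith [two_mul_deviance_mul_exp u]

lemma two_mul_deviance_mul_exp_le_exp_sub_one_sq {u : ℝ} (hu : u ≤ 0) :
    2 * deviance u * Real.exp u ≤ (Real.exp u - 1) ^ 2 := by
  have := mul_nonneg (Real.exp_pos u).le (sub_nonneg.2 (Real.sinh_le_self_iff.2 hu))
  linarith [two_mul_deviance_mul_exp u]

lemma abs_sqrt_two_mul_deviance_sub_abs_le (u : ℝ) :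
    |√(2 * deviance u) - (|Real.exp u - 1|)| ≤ √(2 * deviance u) * |Real.exp u - 1| := by
  set A := √(2 * deviance u)
  have hA : 0 ≤ A := Real.sqrt_nonneg _
  have hsq : A ^ 2 = 2 * deviance u := Real.sq_sqrt (by linarith [deviance_nonneg u])
  have hexp := Real.exp_pos u
  rcases le_total 0 u with hu | hu
  · have h1 : 1 ≤ Real.exp u := Real.one_le_exp hu
    have hle : A ≤ Real.exp u - 1 :=
      le_of_sq_le_sq (hsq.trans_le (two_mul_deviance_le_exp_sub_one_sq hu)) (by linarith)
    have hge : Real.exp u - 1 ≤ A * Real.exp u := by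
      refine le_of_sq_le_sq ((exp_sub_one_sq_le_two_mul_deviance_mul_exp hu).trans ?_)
        (by positivity)
      rw [← hsq, mul_pow]
      gcongr
      exact le_self_pow₀ h1 two_ne_zero
    rw [abs_of_nonneg (sub_nonneg.2 h1), abs_of_nonpos (sub_nonpos.2 hle)]
    linarith
  · have h1 : Real.exp u ≤ 1 := Real.exp_le_one_iff.2 hu
    have hge : 1 - Real.exp u ≤ A :=
      le_of_sq_le_sq (by rw [hsq, sub_sq_comm]; exact exp_sub_one_sq_le_two_mul_deviance hu) hA
    have hle : A * Real.exp u ≤ 1 - Real.exp u := by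
      refine le_of_sq_le_sq (le_trans ?_ (two_mul_deviance_mul_exp_le_exp_sub_one_sq hu) |>.trans_eq
        (sub_sq_comm _ _)) (by linarith)
      rw [← hsq, mul_pow]
      gcongr
      exact pow_le_of_le_one hexp.le h1 two_ne_zero
    rw [abs_of_nonpos (sub_nonpos.2 h1), neg_sub, abs_of_nonneg (sub_nonneg.2 hge)]
    linarith

lemma abs_sqrt_two_mul_deviance_div_sub_one_le {u : ℝ} (hu : u ≠ 0) :
    |√(2 * deviance u) / |Real.exp u - 1| - 1| ≤ √(2 * deviance u) := by
  have hpos : 0 < |Real.exp u - 1| := abs_pos.2 (sub_ne_zero.2 (Real.exp_eq_one_iff u |>.not.2 hu))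
  rw [div_sub_one hpos.ne', abs_div, abs_abs, div_le_iff₀ hpos]
  exact abs_sqrt_two_mul_deviance_sub_abs_le u

end Deviance

section SignedRoot

/-- The signed root of twice the deviance: the increasing function `s` with `s u ^ 2 / 2` equal to
`deviance u` and with the sign of `u`. -/
noncomputable def signedRoot (u : ℝ) : ℝ :=
  if 0 ≤ u then √(2 * deviance u) else -√(2 * deviance u)

lemma sq_signedRoot (u : ℝ) : signedRoot u ^ 2 = 2 * deviance u := by
  have := deviance_nonneg u
  unfold signedRoot
  split_ifs <;> simp only [neg_sq, Real.sq_sqrt (show 0 ≤ 2 * deviance u by linarith)]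

lemma signedRoot_of_nonneg {u : ℝ} (hu : 0 ≤ u) : signedRoot u = √(2 * deviance u) := if_pos hu

lemma signedRoot_of_nonpos {u : ℝ} (hu : u ≤ 0) : signedRoot u = -√(2 * deviance u) := by
  rcases hu.eq_or_lt with rfl | hu
  · simp [signedRoot]
  · exact if_neg hu.not_ge

lemma signedRoot_eq_zero_iff {u : ℝ} : signedRoot u = 0 ↔ u = 0 := by
  refine ⟨fun h => ?_, fun h => by simp [h, signedRoot]⟩
  by_contra hu
  have := sq_signedRoot u
  rw [h] at this
  linarith [deviance_pos hu]

@[fun_prop]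
lemma continuous_signedRoot : Continuous signedRoot :=
  Continuous.if_le (by fun_prop) (by fun_prop) continuous_const continuous_id
    fun u hu => by simp [← hu]

lemma monotone_signedRoot : Monotone signedRoot := by
  refine MonotoneOn.Iic_union_Ici (a := 0) (fun u hu v hv huv => ?_) fun u hu v hv huv => ?_
  · rw [signedRoot_of_nonpos hu, signedRoot_of_nonpos hv, neg_le_neg_iff]
    exact Real.sqrt_le_sqrt (mul_le_mul_of_nonneg_left (antitoneOn_deviance hu hv huv) two_pos.le)
  · rw [signedRoot_of_nonneg hu, signedRoot_of_nonneg hv]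
    exact Real.sqrt_le_sqrt (mul_le_mul_of_nonneg_left (monotoneOn_deviance hu hv huv) two_pos.le)

lemma tendsto_signedRoot_atTop : Filter.Tendsto signedRoot Filter.atTop Filter.atTop := by
  refine Filter.tendsto_atTop_mono' _ ?_ Filter.tendsto_id
  filter_upwards [Filter.eventually_ge_atTop 0] with u hu
  have := Real.quadratic_le_exp_of_nonneg hu
  rw [signedRoot_of_nonneg hu]
  refine Real.le_sqrt_of_sq_le ?_
  rw [id_eq, deviance]
  linarith

lemma tendsto_signedRoot_atBot : Filter.Tendsto signedRoot Filter.atBot Filter.atBot := by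
  have hlin : Filter.Tendsto (fun u : ℝ => 2 * (-1 - u)) Filter.atBot Filter.atTop :=
    (Filter.tendsto_atTop_add_const_left _ _ Filter.tendsto_neg_atBot_atTop).const_mul_atTop two_pos
  refine Filter.tendsto_atBot_mono' _ ?_
    (Filter.tendsto_neg_atTop_atBot.comp (Real.tendsto_sqrt_atTop.comp hlin))
  filter_upwards [Filter.eventually_le_atBot 0] with u hu
  rw [signedRoot_of_nonpos hu]
  refine neg_le_neg (Real.sqrt_le_sqrt ?_)
  have := Real.exp_pos u
  rw [deviance]
  linarith

lemma surjective_signedRoot : Function.Surjective signedRoot :=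
  continuous_signedRoot.surjective tendsto_signedRoot_atTop tendsto_signedRoot_atBot

lemma image_const_mul_signedRoot {c : ℝ} (hc : c ≠ 0) :
    (fun u => c * signedRoot u) '' {0}ᶜ = {0}ᶜ := by
  have hsurj : Function.Surjective fun u => c * signedRoot u :=
    (mul_left_surjective₀ hc).comp surjective_signedRoot
  have hpre : (fun u => c * signedRoot u) ⁻¹' {0}ᶜ = {0}ᶜ := by
    ext u
    simp [hc, signedRoot_eq_zero_iff]
  conv_lhs => rw [← hpre, Set.image_preimage_eq _ hsurj]

lemma hasDerivAt_signedRoot {u : ℝ} (hu : u ≠ 0) :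
    HasDerivAt signedRoot (|Real.exp u - 1| / √(2 * deviance u)) u := by
  have hsqrt : HasDerivAt (fun u => √(2 * deviance u))
      ((Real.exp u - 1) / √(2 * deviance u)) u := by
    refine (((hasDerivAt_deviance u).const_mul 2).sqrt
      (mul_pos two_pos (deviance_pos hu)).ne').congr_deriv ?_
    rw [mul_div_mul_left _ _ two_ne_zero]
  rcases hu.lt_or_gt with hu | hu
  · rw [abs_of_nonpos (sub_nonpos.2 (Real.exp_le_one_iff.2 hu.le)), neg_div]
    refine hsqrt.neg.congr_of_eventuallyEq ?_
    filter_upwards [Iio_mem_nhds hu] with v hv using signedRoot_of_nonpos (Set.mem_Iio.1 hv).le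
  · rw [abs_of_nonneg (sub_nonneg.2 (Real.one_le_exp hu.le))]
    refine hsqrt.congr_of_eventuallyEq ?_
    filter_upwards [Ioi_mem_nhds hu] with v hv using signedRoot_of_nonneg (Set.mem_Ioi.1 hv).le

end SignedRoot

section DevianceLaw

lemma map_withDensity_deriv_mul {s : Set ℝ} (hs : MeasurableSet s) {φ φ' : ℝ → ℝ}
    (hφ : Measurable φ) (hφ' : Measurable φ') (hderiv : ∀ u ∈ s, HasDerivWithinAt φ (φ' u) s u)
    (hmono : MonotoneOn φ s) {p : ℝ → ENNReal} (hp : Measurable p) :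
    ((volume.restrict s).withDensity fun u => ENNReal.ofReal (φ' u) * p (φ u)).map φ =
      (volume.restrict (φ '' s)).withDensity p := by
  refine Measure.ext_of_lintegral _ fun F hF => ?_
  rw [lintegral_map hF hφ,
    lintegral_withDensity_eq_lintegral_mul _ (by fun_prop) (by fun_prop),
    lintegral_withDensity_eq_lintegral_mul _ hp hF,
    lintegral_image_eq_lintegral_deriv_mul_of_monotoneOn hs hderiv hmono]
  simp only [Pi.mul_apply, mul_assoc]

/-- The density that the change of variables `z = √a * signedRoot u` makes of the standard
Gaussian density. -/
noncomputable def devianceWeight (a u : ℝ) : ℝ :=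
  √(a / (2 * Real.pi)) * Real.exp (-(a * deviance u)) * (|Real.exp u - 1| / √(2 * deviance u))

/-- The law on the real line under which `√a * signedRoot` is a standard Gaussian variable. -/
noncomputable def devianceLaw (a : ℝ) : Measure ℝ :=
  volume.withDensity fun u => ENNReal.ofReal (devianceWeight a u)

@[fun_prop]
lemma measurable_devianceWeight (a : ℝ) : Measurable (devianceWeight a) := by
  unfold devianceWeight
  fun_prop

lemma devianceWeight_nonneg (a u : ℝ) : 0 ≤ devianceWeight a u := by
  unfold devianceWeight
  positivity

lemma ae_devianceLaw_ne_zero (a : ℝ) : ∀ᵐ u ∂devianceLaw a, u ≠ 0 :=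
  (withDensity_absolutelyContinuous _ _).ae_le (Measure.ae_ne volume 0)

variable {a : ℝ}

lemma devianceWeight_eq_deriv_mul_gaussianPDFReal (ha : 0 ≤ a) (u : ℝ) :
    devianceWeight a u = √a * (|Real.exp u - 1| / √(2 * deviance u)) *
      gaussianPDFReal 0 1 (√a * signedRoot u) := by
  have hsq : -(√a * signedRoot u - 0) ^ 2 / (2 * (1 : NNReal)) = -(a * deviance u) := by
    rw [sub_zero, mul_pow, Real.sq_sqrt ha, sq_signedRoot]
    push_cast
    ring
  rw [devianceWeight, gaussianPDFReal, hsq, Real.sqrt_div ha, NNReal.coe_one, mul_one]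
  ring

lemma hasLaw_signedRoot_devianceLaw (ha : 0 < a) :
    HasLaw (fun u => √a * signedRoot u) (gaussianReal 0 1) (devianceLaw a) where
  aemeasurable := by fun_prop
  map_eq := by
    have hweight : (fun u => ENNReal.ofReal (devianceWeight a u)) = fun u =>
        ENNReal.ofReal (√a * (|Real.exp u - 1| / √(2 * deviance u))) *
          gaussianPDF 0 1 (√a * signedRoot u) := by
      ext u
      rw [devianceWeight_eq_deriv_mul_gaussianPDFReal ha.le, ENNReal.ofReal_mul (by positivity),
        gaussianPDF]
    have := map_withDensity_deriv_mul (measurableSet_singleton (0 : ℝ)).compl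
      (φ := fun u => √a * signedRoot u) (by fun_prop) (by fun_prop)
      (fun u hu => ((hasDerivAt_signedRoot hu).const_mul √a).hasDerivWithinAt)
      ((monotone_signedRoot.const_mul (Real.sqrt_nonneg a)).monotoneOn _)
      (measurable_gaussianPDF 0 1)
    rwa [image_const_mul_signedRoot (Real.sqrt_pos.2 ha).ne', restrict_compl_singleton, ← hweight,
      ← gaussianReal_of_var_ne_zero _ one_ne_zero] at this

lemma isProbabilityMeasure_devianceLaw (ha : 0 < a) : IsProbabilityMeasure (devianceLaw a) :=
  (hasLaw_signedRoot_devianceLaw ha).isProbabilityMeasure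

end DevianceLaw

section DensityComparison

variable {α : Type*} [MeasurableSpace α] {ν : Measure α}

lemma integrable_of_isProbabilityMeasure_withDensity {q : α → ℝ} (hq : Measurable q)
    (hq0 : ∀ x, 0 ≤ q x)
    (hprob : IsProbabilityMeasure (ν.withDensity fun x => ENNReal.ofReal (q x))) :
    Integrable q ν := by
  rw [← lintegral_ofReal_ne_top_iff_integrable hq.aestronglyMeasurable
    (Filter.Eventually.of_forall hq0), ← setLIntegral_univ, ← withDensity_apply _ .univ,
    measure_univ]
  exact ENNReal.one_ne_top

lemma integral_withDensity_ofReal {q : α → ℝ} (hq : Measurable q) (hq0 : ∀ x, 0 ≤ q x)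
    (H : α → ℝ) :
    ∫ x, H x ∂ν.withDensity (fun x => ENNReal.ofReal (q x)) = ∫ x, q x * H x ∂ν := by
  rw [integral_withDensity_eq_integral_toReal_smul hq.ennreal_ofReal
    (Filter.Eventually.of_forall fun _ => ENNReal.ofReal_lt_top)]
  simp_rw [ENNReal.toReal_ofReal (hq0 _), smul_eq_mul]

lemma integral_eq_one_of_isProbabilityMeasure_withDensity {q : α → ℝ} (hq : Measurable q)
    (hq0 : ∀ x, 0 ≤ q x)
    (hprob : IsProbabilityMeasure (ν.withDensity fun x => ENNReal.ofReal (q x))) :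
    ∫ x, q x ∂ν = 1 := by
  simpa using (integral_withDensity_ofReal hq hq0 (ν := ν) fun _ => 1).symm

variable [IsProbabilityMeasure ν]

lemma abs_integral_withDensity_sub_integral_le {q g H : α → ℝ} (hq : Measurable q)
    (hq0 : ∀ x, 0 ≤ q x)
    (hprob : IsProbabilityMeasure (ν.withDensity fun x => ENNReal.ofReal (q x)))
    (hH : Integrable H ν) (hg : Integrable g ν) (c : ℝ)
    (hbound : ∀ᵐ x ∂ν, |(q x - 1) * (H x - c)| ≤ g x) :
    |∫ x, H x ∂ν.withDensity (fun x => ENNReal.ofReal (q x)) - ∫ x, H x ∂ν| ≤ ∫ x, g x ∂ν := by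
  have hqint : Integrable (fun x => q x - 1) ν :=
    (integrable_of_isProbabilityMeasure_withDensity hq hq0 hprob).sub (integrable_const 1)
  have hzero : ∫ x, (q x - 1) ∂ν = 0 := by
    rw [integral_sub (integrable_of_isProbabilityMeasure_withDensity hq hq0 hprob)
      (integrable_const 1), integral_eq_one_of_isProbabilityMeasure_withDensity hq hq0 hprob]
    simp
  have hprod : Integrable (fun x => (q x - 1) * (H x - c)) ν :=
    hg.mono' (hqint.aestronglyMeasurable.mul
      (hH.aestronglyMeasurable.sub aestronglyMeasurable_const)) hbound
  have hexpand : ∫ x, q x * H x ∂ν = ∫ x, (q x - 1) * (H x - c) ∂ν + ∫ x, H x ∂ν := by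
    calc ∫ x, q x * H x ∂ν
        = ∫ x, ((q x - 1) * (H x - c) + (H x + c * (q x - 1))) ∂ν := by
          congr with x
          ring
      _ = _ := by
          rw [integral_add (g := fun x => H x + c * (q x - 1)) hprod
              (hH.add (hqint.const_mul c)), integral_add hH (hqint.const_mul c),
            integral_const_mul, hzero, mul_zero, add_zero]
  rw [integral_withDensity_ofReal hq hq0, hexpand, add_sub_cancel_right]
  exact norm_integral_le_of_norm_le (f := fun x => (q x - 1) * (H x - c)) hg hbound

variable {k δ : ℝ} {ρ Z : α → ℝ}

lemma integral_abs_le_one_of_integral_sq_eq_one (hZ : MemLp Z 2 ν) (hsq : ∫ x, Z x ^ 2 ∂ν = 1) :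
    ∫ x, |Z x| ∂ν ≤ 1 := by
  calc ∫ x, |Z x| ∂ν ≤ ∫ x, (1 + Z x ^ 2) / 2 ∂ν := by
        refine integral_mono (hZ.integrable one_le_two).abs
          (((integrable_const _).add hZ.integrable_sq).div_const _) fun x => ?_
        have := sq_nonneg (|Z x| - 1)
        rw [sub_sq, sq_abs] at this
        dsimp only
        linarith
    _ = 1 := by
        rw [integral_div, integral_add (integrable_const _) hZ.integrable_sq, hsq]
        norm_num

lemma one_sub_le_of_isProbabilityMeasure_withDensity (hk0 : 0 ≤ k) (hk1 : k ≤ 1) (hδ : 0 ≤ δ)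
    (hρ : Measurable ρ) (hρ0 : ∀ x, 0 ≤ ρ x)
    (hprob : IsProbabilityMeasure (ν.withDensity fun x => ENNReal.ofReal (k * ρ x)))
    (hZ : MemLp Z 2 ν) (hsq : ∫ x, Z x ^ 2 ∂ν = 1) (hbound : ∀ᵐ x ∂ν, |ρ x - 1| ≤ δ * |Z x|) :
    1 - k ≤ δ := by
  have hZint : Integrable (fun x => |Z x|) ν := (hZ.integrable one_le_two).abs
  have hmean : 1 ≤ k * (1 + δ) := by
    calc 1 = ∫ x, k * ρ x ∂ν := (integral_eq_one_of_isProbabilityMeasure_withDensity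
          (hρ.const_mul k) (fun x => mul_nonneg hk0 (hρ0 x)) hprob).symm
      _ ≤ ∫ x, k * (1 + δ * |Z x|) ∂ν := by
          refine integral_mono_ae (integrable_of_isProbabilityMeasure_withDensity
            (hρ.const_mul k) (fun x => mul_nonneg hk0 (hρ0 x)) hprob)
            (((integrable_const _).add (hZint.const_mul δ)).const_mul k) ?_
          filter_upwards [hbound] with x hx
          exact mul_le_mul_of_nonneg_left (by linarith [le_abs_self (ρ x - 1)]) hk0
      _ = k * (1 + δ * ∫ x, |Z x| ∂ν) := by
          rw [integral_const_mul, integral_add (integrable_const _) (hZint.const_mul δ),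
            integral_const_mul]
          simp
      _ ≤ k * (1 + δ * 1) := by
          gcongr
          exact integral_abs_le_one_of_integral_sq_eq_one hZ hsq
      _ = k * (1 + δ) := by rw [mul_one]
  nlinarith

lemma abs_mul_sub_one_mul_le_of_abs_sub_one_le {r z y L : ℝ} (hk0 : 0 ≤ k) (hk1 : k ≤ 1)
    (hδ : 0 ≤ δ) (hk : 1 - k ≤ δ) (hr : |r - 1| ≤ δ * |z|) (hy : |y| ≤ L * z ^ 2) :
    |(k * r - 1) * y| ≤ L * δ * ((3 * z ^ 2 + z ^ 4) / 2) := by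
  have hdensity : |k * r - 1| ≤ δ * (1 + |z|) := by
    calc |k * r - 1| = |k * (r - 1) - (1 - k)| := by ring_nf
      _ ≤ k * |r - 1| + (1 - k) := by
          refine (abs_sub _ _).trans_eq ?_
          rw [abs_mul, abs_of_nonneg hk0, abs_of_nonneg (sub_nonneg.2 hk1)]
      _ ≤ 1 * (δ * |z|) + δ := by gcongr
      _ = δ * (1 + |z|) := by ring
  have hAMGM : 1 + |z| ≤ (3 + z ^ 2) / 2 := by
    have := sq_nonneg (|z| - 1)
    rw [sub_sq, sq_abs] at this
    linarith
  calc |(k * r - 1) * y| = |k * r - 1| * |y| := abs_mul _ _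
    _ ≤ δ * (1 + |z|) * (L * z ^ 2) := by gcongr
    _ ≤ δ * ((3 + z ^ 2) / 2) * (L * z ^ 2) := by
        have := (abs_nonneg _).trans hy
        gcongr
    _ = L * δ * ((3 * z ^ 2 + z ^ 4) / 2) := by ring

lemma abs_integral_withDensity_sub_integral_le_of_abs_sub_le_sq
    (hk0 : 0 ≤ k) (hk1 : k ≤ 1) (hδ : 0 ≤ δ) (hρ : Measurable ρ) (hρ0 : ∀ x, 0 ≤ ρ x)
    (hprob : IsProbabilityMeasure (ν.withDensity fun x => ENNReal.ofReal (k * ρ x)))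
    (hZ : MemLp Z 4 ν) (hsq : ∫ x, Z x ^ 2 ∂ν = 1) (hbound : ∀ᵐ x ∂ν, |ρ x - 1| ≤ δ * |Z x|)
    {H : α → ℝ} (hH : Measurable H) {c L : ℝ} (hL : ∀ᵐ x ∂ν, |H x - c| ≤ L * Z x ^ 2) :
    |∫ x, H x ∂ν.withDensity (fun x => ENNReal.ofReal (k * ρ x)) - ∫ x, H x ∂ν| ≤
      L * δ * ((3 + ∫ x, Z x ^ 4 ∂ν) / 2) := by
  have hZ2 : MemLp Z 2 ν := hZ.mono_exponent (by norm_num)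
  have hZ4 : Integrable (fun x => Z x ^ 4) ν :=
    (hZ.integrable_norm_pow (by norm_num)).congr (Filter.Eventually.of_forall fun x => by
      simp [Even.pow_abs (show Even 4 by decide)])
  have hHint : Integrable H ν := by
    have : Integrable (fun x => H x - c) ν :=
      (hZ2.integrable_sq.const_mul L).mono' (by fun_prop) hL
    exact (this.add (integrable_const c)).congr
      (Filter.Eventually.of_forall fun _ => sub_add_cancel _ _)
  have hk := one_sub_le_of_isProbabilityMeasure_withDensity hk0 hk1 hδ hρ hρ0 hprob hZ2 hsq hbound
  have hmajorant : Integrable (fun x => L * δ * ((3 * Z x ^ 2 + Z x ^ 4) / 2)) ν :=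
    (((hZ2.integrable_sq.const_mul 3).add hZ4).div_const 2).const_mul _
  refine (abs_integral_withDensity_sub_integral_le (hρ.const_mul k)
    (fun x => mul_nonneg hk0 (hρ0 x)) hprob hHint hmajorant c ?_).trans_eq ?_
  · filter_upwards [hbound, hL] with x hx hLx
    exact abs_mul_sub_one_mul_le_of_abs_sub_one_le hk0 hk1 hδ hk hx hLx
  · rw [integral_const_mul, integral_div, integral_add (hZ2.integrable_sq.const_mul 3) hZ4,
      integral_const_mul, hsq, mul_one]

end DensityComparison

section GammaAddition

variable {a b r : ℝ}

@[fun_prop]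
lemma measurable_gammaPDF (a r : ℝ) : Measurable (gammaPDF a r) :=
  (measurable_gammaPDFReal a r).ennreal_ofReal

lemma mul_gammaPDF_mul_gammaPDF_eq_gammaPDF_mul_betaPDF (ha : 0 < a) (hb : 0 < b) (hr : 0 < r)
    {x u : ℝ} (hx : 0 < x) (hu0 : u ≠ 0) (hu1 : u ≠ 1) :
    ENNReal.ofReal x * (gammaPDF a r (x * u) * gammaPDF b r (-(x * u) + x)) =
      gammaPDF (a + b) r x * betaPDF a b u := by
  rcases hu0.lt_or_gt with hneg | hpos
  · rw [gammaPDF_of_neg (mul_neg_of_pos_of_neg hx hneg), betaPDF_eq_zero_of_nonpos hneg.le,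
      zero_mul, mul_zero, mul_zero]
  rcases hu1.lt_or_gt with hlt | hgt
  · have hcomplement : -(x * u) + x = x * (1 - u) := by ring
    have hsub : 0 < 1 - u := sub_pos.2 hlt
    have hexp : Real.exp (-(r * x)) =
        Real.exp (-(r * (x * u))) * Real.exp (-(r * (x * (1 - u)))) := by
      rw [← Real.exp_add]
      ring_nf
    have := Real.Gamma_pos_of_pos ha
    have := Real.Gamma_pos_of_pos hb
    have := Real.Gamma_pos_of_pos (add_pos ha hb)
    rw [hcomplement, gammaPDF_of_nonneg (by positivity), gammaPDF_of_nonneg (by positivity),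
      gammaPDF_of_nonneg hx.le, betaPDF_of_pos_lt_one hpos hlt,
      ← ENNReal.ofReal_mul (by positivity), ← ENNReal.ofReal_mul (by positivity),
      ← ENNReal.ofReal_mul (by positivity), hexp, beta, Real.mul_rpow hx.le hpos.le,
      Real.mul_rpow hx.le hsub.le, Real.rpow_add hr,
      show a + b - 1 = (a - 1) + (b - 1) + 1 by ring, Real.rpow_add_one hx.ne', Real.rpow_add hx]
    congr 1
    field_simp
  · rw [gammaPDF_of_neg (x := -(x * u) + x) (by nlinarith), betaPDF_eq_zero_of_one_le hgt.le,
      mul_zero, mul_zero, mul_zero]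

lemma lconvolution_gammaPDF_gammaPDF (ha : 0 < a) (hb : 0 < b) (hr : 0 < r) {x : ℝ} (hx : x ≠ 0) :
    lconvolution (gammaPDF a r) (gammaPDF b r) volume x = gammaPDF (a + b) r x := by
  rw [lconvolution_def]
  rcases hx.lt_or_gt with hneg | hpos
  · rw [gammaPDF_of_neg hneg, lintegral_eq_zero_iff (by fun_prop)]
    refine Filter.Eventually.of_forall fun y => ?_
    rcases lt_or_ge y 0 with hy | hy
    · simp [gammaPDF_of_neg hy]
    · simp [gammaPDF_of_neg (show -y + x < 0 by linarith)]
  · calc ∫⁻ y, gammaPDF a r y * gammaPDF b r (-y + x)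
        = ∫⁻ u, ENNReal.ofReal x * (gammaPDF a r (x * u) * gammaPDF b r (-(x * u) + x)) := by
          conv_lhs => rw [← Real.smul_map_volume_mul_left hpos.ne', abs_of_pos hpos]
          rw [lintegral_smul_measure, lintegral_map (by fun_prop) (by fun_prop),
            lintegral_const_mul _ (by fun_prop), smul_eq_mul]
      _ = ∫⁻ u, gammaPDF (a + b) r x * betaPDF a b u := by
          refine lintegral_congr_ae ?_
          filter_upwards [Measure.ae_ne volume (0 : ℝ), Measure.ae_ne volume (1 : ℝ)] with u hu0 hu1
          exact mul_gammaPDF_mul_gammaPDF_eq_gammaPDF_mul_betaPDF ha hb hr hpos hu0 hu1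
      _ = gammaPDF (a + b) r x := by
          rw [lintegral_const_mul (f := betaPDF a b) _
              (measurable_betaPDFReal a b).ennreal_ofReal,
            lintegral_betaPDF_eq_one ha hb, mul_one]

lemma gammaMeasure_conv_gammaMeasure (ha : 0 < a) (hb : 0 < b) (hr : 0 < r) :
    (gammaMeasure a r).conv (gammaMeasure b r) = gammaMeasure (a + b) r := by
  rw [gammaMeasure, gammaMeasure, gammaMeasure,
    conv_withDensity_eq_lconvolution (measurable_gammaPDF a r) (measurable_gammaPDF b r)]
  refine withDensity_congr_ae ?_
  filter_upwards [Measure.ae_ne volume (0 : ℝ)] with x hx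
  exact lconvolution_gammaPDF_gammaPDF ha hb hr hx

lemma hasLaw_sum_gammaMeasure {ι Ω : Type*} [MeasurableSpace Ω] {P : Measure Ω} {a : ι → ℝ}
    (ha : ∀ i, 0 < a i) (hr : 0 < r) {X : ι → Ω → ℝ}
    (hX : ∀ i, HasLaw (X i) (gammaMeasure (a i) r) P) (hind : iIndepFun X P) {s : Finset ι}
    (hs : s.Nonempty) : HasLaw (∑ i ∈ s, X i) (gammaMeasure (∑ i ∈ s, a i) r) P := by
  induction hs using Finset.Nonempty.cons_induction with
  | singleton i => simpa using hX i
  | cons i s hi hs ih =>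
    have hsum : 0 < ∑ j ∈ s, a j := Finset.sum_pos (fun j _ => ha j) hs
    have := isProbabilityMeasure_gammaMeasure (ha i) hr
    have := isProbabilityMeasure_gammaMeasure hsum hr
    have := (hX i).isProbabilityMeasure
    rw [Finset.sum_cons, Finset.sum_cons, add_comm (X i), add_comm (a i),
      ← gammaMeasure_conv_gammaMeasure hsum (ha i) hr]
    have hindep := hind.indepFun_finsetSum_of_notMem₀ (fun j => (hX j).aemeasurable) hi
    exact hindep.hasLaw_add ih (hX i)

end GammaAddition

section GammaLogLaw

lemma integral_pow_two_mul_gaussianReal (k : ℕ) :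
    ∫ z, z ^ (2 * k) ∂gaussianReal 0 1 = (2 * k - 1 : ℕ).doubleFactorial := by
  have hpow : (1 / 2 : ℝ) ^ (-((2 * k : ℕ) + 1 : ℝ) / 2) = 2 ^ k * √2 := by
    rw [one_div, Real.inv_rpow two_pos.le, ← Real.rpow_neg two_pos.le, Real.sqrt_eq_rpow,
      ← Real.rpow_natCast 2 k, ← Real.rpow_add two_pos]
    push_cast
    ring_nf
  have hhalf : ∫ z in Set.Ioi (0 : ℝ), z ^ (2 * k) * Real.exp (-(1 / 2) * z ^ 2) =
      2 ^ k * √2 * (1 / 2) * ((2 * k - 1 : ℕ).doubleFactorial * √Real.pi / 2 ^ k) := by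
    rw [← Real.Gamma_nat_add_half, ← hpow, show (k : ℝ) + 1 / 2 = ((2 * k : ℕ) + 1 : ℝ) / 2 by
      push_cast; ring, ← integral_rpow_mul_exp_neg_mul_rpow two_pos
      (by linarith [(2 * k : ℕ).cast_nonneg (α := ℝ)]) one_half_pos]
    simp_rw [Real.rpow_natCast, Real.rpow_two]
  calc ∫ z, z ^ (2 * k) ∂gaussianReal 0 1
      = ∫ z, (√(2 * Real.pi))⁻¹ *
          (fun z : ℝ => z ^ (2 * k) * Real.exp (-(1 / 2) * z ^ 2)) |z| := by
        rw [integral_gaussianReal_eq_integral_smul one_ne_zero]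
        congr with z
        simp only [gaussianPDFReal, NNReal.coe_one, mul_one, sub_zero, smul_eq_mul, sq_abs,
          (even_two_mul k).pow_abs]
        ring_nf
    _ = (2 * k - 1 : ℕ).doubleFactorial := by
        rw [integral_const_mul, integral_comp_abs
          (f := fun z : ℝ => z ^ (2 * k) * Real.exp (-(1 / 2) * z ^ 2)), hhalf,
          Real.sqrt_mul two_pos.le]
        have := Real.sqrt_pos.2 Real.pi_pos
        field_simp

/-- The ratio of Stirling's approximation of `Γ (a + 1)` to `Γ (a + 1)`: the constant factor
by which the density of the logarithm of a gamma variable of shape `a`, divided by its mean,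
falls short of its Laplace approximation. -/
noncomputable def stirlingRatio (a : ℝ) : ℝ :=
  √(2 * Real.pi * a) * (a / Real.exp 1) ^ a / Real.Gamma (a + 1)

lemma stirlingRatio_nonneg {a : ℝ} (ha : 0 ≤ a) : 0 ≤ stirlingRatio a := by
  have := Real.Gamma_nonneg_of_nonneg (by linarith : 0 ≤ a + 1)
  unfold stirlingRatio
  positivity

lemma stirlingRatio_natCast_le_one (n : ℕ) : stirlingRatio n ≤ 1 := by
  rw [stirlingRatio, Real.Gamma_nat_eq_factorial, div_le_one (by positivity), Real.rpow_natCast]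
  exact Stirling.le_factorial_stirling n

variable {a r : ℝ}

lemma mul_exp_mul_gammaPDFReal_mul_exp (ha : 0 < a) (hr : 0 < r) {u : ℝ} (hu : u ≠ 0) :
    a / r * Real.exp u * gammaPDFReal a r (a / r * Real.exp u) = devianceWeight a u *
      (stirlingRatio a * (√(2 * deviance u) / |Real.exp u - 1|)) := by
  have hdeviance : √(2 * deviance u) ≠ 0 :=
    (Real.sqrt_pos.2 (mul_pos two_pos (deviance_pos hu))).ne'
  have habs : |Real.exp u - 1| ≠ 0 := by simpa [sub_eq_zero] using hu
  have hsqrt : √(a / (2 * Real.pi)) * √(2 * Real.pi * a) = a := by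
    rw [← Real.sqrt_mul (by positivity), show a / (2 * Real.pi) * (2 * Real.pi * a) = a ^ 2 by
      field_simp, Real.sqrt_sq ha.le]
  have hexp : Real.exp (-(a * deviance u)) =
      Real.exp (a * u) * Real.exp a * Real.exp (-(a * Real.exp u)) := by
    rw [deviance, ← Real.exp_add, ← Real.exp_add]
    ring_nf
  calc a / r * Real.exp u * gammaPDFReal a r (a / r * Real.exp u)
      = (r ^ a * (a / r * Real.exp u) ^ a) * Real.exp (-(a * Real.exp u)) / Real.Gamma a := by
        rw [gammaPDFReal, if_pos (by positivity), Real.rpow_sub_one (by positivity),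
          ← mul_assoc r, mul_div_cancel₀ _ hr.ne']
        field_simp
    _ = a ^ a * Real.exp (a * u) * Real.exp (-(a * Real.exp u)) / Real.Gamma a := by
        rw [← Real.mul_rpow hr.le (by positivity), ← mul_assoc r, mul_div_cancel₀ _ hr.ne',
          Real.mul_rpow ha.le (Real.exp_pos u).le, ← Real.exp_mul, mul_comm u]
    _ = √(a / (2 * Real.pi)) * √(2 * Real.pi * a) * (a ^ a / Real.exp a) / Real.Gamma (a + 1) *
          Real.exp (-(a * deviance u)) := by
        rw [hsqrt, hexp, Real.Gamma_add_one ha.ne']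
        have := (Real.Gamma_pos_of_pos ha).ne'
        field_simp
    _ = devianceWeight a u * (stirlingRatio a * (√(2 * deviance u) / |Real.exp u - 1|)) := by
        rw [devianceWeight, stirlingRatio, Real.div_rpow ha.le (Real.exp_pos 1).le,
          ← Real.exp_mul, one_mul]
        field_simp

lemma gammaMeasure_eq_withDensity_restrict_Ioi (a r : ℝ) :
    gammaMeasure a r = (volume.restrict (Set.Ioi 0)).withDensity (gammaPDF a r) := by
  rw [← withDensity_indicator measurableSet_Ioi]
  refine withDensity_congr_ae ?_
  filter_upwards [Measure.ae_ne volume (0 : ℝ)] with x hx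
  rcases hx.lt_or_gt with hneg | hpos
  · rw [gammaPDF_of_neg hneg, Set.indicator_of_notMem (by simpa using hneg.le)]
  · rw [Set.indicator_of_mem (Set.mem_Ioi.2 hpos)]

lemma map_withDensity_devianceLaw (ha : 0 < a) (hr : 0 < r) :
    ((devianceLaw a).withDensity fun u => ENNReal.ofReal
      (stirlingRatio a * (√(2 * deviance u) / |Real.exp u - 1|))).map
        (fun u => a / r * Real.exp u) = gammaMeasure a r := by
  have himage : (fun u => a / r * Real.exp u) '' Set.univ = Set.Ioi 0 := by
    rw [← Set.image_image (a / r * ·), Set.image_univ, Real.range_exp,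
      Set.image_const_mul_Ioi_zero (by positivity)]
  rw [gammaMeasure_eq_withDensity_restrict_Ioi, ← himage, ← map_withDensity_deriv_mul .univ
    (φ' := fun u => a / r * Real.exp u) (by fun_prop) (by fun_prop)
    (fun u _ => ((Real.hasDerivAt_exp u).const_mul _).hasDerivWithinAt)
    ((Real.exp_monotone.const_mul (by positivity)).monotoneOn _) (by fun_prop),
    devianceLaw, ← withDensity_mul _ (by fun_prop) (by fun_prop), Measure.restrict_univ]
  congr 1
  refine withDensity_congr_ae ?_
  filter_upwards [Measure.ae_ne volume (0 : ℝ)] with u hu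
  rw [Pi.mul_apply, ← ENNReal.ofReal_mul (devianceWeight_nonneg a u),
    ← mul_exp_mul_gammaPDFReal_mul_exp ha hr hu, ENNReal.ofReal_mul (by positivity), gammaPDF]

lemma isProbabilityMeasure_withDensity_devianceLaw (ha : 0 < a) :
    IsProbabilityMeasure ((devianceLaw a).withDensity fun u => ENNReal.ofReal
      (stirlingRatio a * (√(2 * deviance u) / |Real.exp u - 1|))) := by
  have : IsProbabilityMeasure (gammaMeasure a 1) := isProbabilityMeasure_gammaMeasure ha one_pos
  rw [← map_withDensity_devianceLaw ha one_pos] at this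
  exact Measure.isProbabilityMeasure_of_map (fun u => a / 1 * Real.exp u)

lemma integral_pow_two_mul_devianceLaw (ha : 0 < a) (k : ℕ) :
    ∫ u, (√a * signedRoot u) ^ (2 * k) ∂devianceLaw a = (2 * k - 1 : ℕ).doubleFactorial := by
  rw [← integral_pow_two_mul_gaussianReal]
  exact (hasLaw_signedRoot_devianceLaw ha).integral_comp (f := fun z => z ^ (2 * k))
    (Measurable.aestronglyMeasurable (by fun_prop))

lemma sq_sqrt_mul_signedRoot (ha : 0 ≤ a) (u : ℝ) :
    (√a * signedRoot u) ^ 2 = 2 * a * deviance u := by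
  rw [mul_pow, Real.sq_sqrt ha, sq_signedRoot]
  ring

lemma abs_sqrt_mul_signedRoot (a u : ℝ) : |√a * signedRoot u| = √a * √(2 * deviance u) := by
  rw [abs_mul, abs_of_nonneg (Real.sqrt_nonneg a), ← sq_signedRoot, Real.sqrt_sq_eq_abs]

variable {n : ℕ} {h : ℝ → ℝ} {L : ℝ}

lemma abs_integral_withDensity_devianceLaw_sub_le (hn : n ≠ 0) (hh : Measurable h)
    (hL : ∀ t, 0 ≤ t → |h t - h 0| ≤ L * t) :
    |∫ u, h (2 * n * deviance u) ∂(devianceLaw n).withDensity (fun u => ENNReal.ofReal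
        (stirlingRatio n * (√(2 * deviance u) / |Real.exp u - 1|))) -
      ∫ u, h (2 * n * deviance u) ∂devianceLaw n| ≤ 3 * L / √n := by
  have hn0 : (0 : ℝ) < n := by positivity
  have hlaw := hasLaw_signedRoot_devianceLaw hn0
  have : IsProbabilityMeasure (devianceLaw n) := isProbabilityMeasure_devianceLaw hn0
  have hfourth : ∫ u, (√n * signedRoot u) ^ 4 ∂devianceLaw n = 3 := by
    simpa using integral_pow_two_mul_devianceLaw hn0 2
  refine (abs_integral_withDensity_sub_integral_le_of_abs_sub_le_sq
    (Z := fun u => √n * signedRoot u) (c := h 0) (L := L) (δ := (√n)⁻¹)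
    (stirlingRatio_nonneg hn0.le) (stirlingRatio_natCast_le_one n) (by positivity) (by fun_prop)
    (fun u => by positivity) (isProbabilityMeasure_withDensity_devianceLaw hn0)
    ((memLp_id_gaussianReal 4).comp_measurePreserving (hlaw.measurePreserving (by fun_prop)))
    (by simpa using integral_pow_two_mul_devianceLaw hn0 1) ?_ (by fun_prop) ?_).trans_eq ?_
  · filter_upwards [ae_devianceLaw_ne_zero n] with u hu
    rw [abs_sqrt_mul_signedRoot, inv_mul_cancel_left₀ (by positivity)]
    exact abs_sqrt_two_mul_deviance_div_sub_one_le hu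
  · refine Filter.Eventually.of_forall fun u => ?_
    rw [sq_sqrt_mul_signedRoot hn0.le]
    exact hL _ (mul_nonneg (by positivity) (deviance_nonneg u))
  · rw [hfourth]
    ring

lemma abs_integral_gammaMeasure_sub_integral_gaussianReal_le (hn : n ≠ 0) (hr : 0 < r)
    (hh : Measurable h) (hL : ∀ t, 0 ≤ t → |h t - h 0| ≤ L * t) :
    |∫ s, h (2 * n * deviance (Real.log (s / (n / r)))) ∂gammaMeasure n r -
      ∫ z, h (z ^ 2) ∂gaussianReal 0 1| ≤ 3 * L / √n := by
  have hn0 : (0 : ℝ) < n := by positivity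
  have hscale : (n : ℝ) / r ≠ 0 := by positivity
  rw [← map_withDensity_devianceLaw hn0 hr, integral_map (by fun_prop)
      (Measurable.aestronglyMeasurable (by fun_prop)),
    ← (hasLaw_signedRoot_devianceLaw hn0).integral_comp (f := fun z => h (z ^ 2))
      (Measurable.aestronglyMeasurable (by fun_prop))]
  simp only [Function.comp_def, mul_div_cancel_left₀ _ hscale, Real.log_exp,
    sq_sqrt_mul_signedRoot hn0.le]
  exact abs_integral_withDensity_devianceLaw_sub_le hn hh hL

end GammaLogLaw

section GammaMoments

variable {a r : ℝ}

lemma integrable_gammaPDFReal (ha : 0 < a) (hr : 0 < r) : Integrable (gammaPDFReal a r) := by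
  have hfinite : ∫⁻ x, gammaPDF a r x ≠ ⊤ := by simp [lintegral_gammaPDF_eq_one ha hr]
  refine (integrable_toReal_of_lintegral_ne_top (by fun_prop) hfinite).congr
    (Filter.Eventually.of_forall fun x => ?_)
  exact ENNReal.toReal_ofReal (gammaPDFReal_nonneg ha hr x)

lemma integral_gammaPDFReal (ha : 0 < a) (hr : 0 < r) : ∫ x, gammaPDFReal a r x = 1 := by
  rw [integral_eq_lintegral_of_nonneg_ae
    (Filter.Eventually.of_forall (gammaPDFReal_nonneg ha hr))
    (measurable_gammaPDFReal a r).aestronglyMeasurable]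
  exact (congrArg ENNReal.toReal (lintegral_gammaPDF_eq_one ha hr)).trans ENNReal.toReal_one

lemma gammaPDFReal_mul_pow (ha : 0 < a) (hr : 0 < r) (k : ℕ) {x : ℝ} (hx : x ≠ 0) :
    gammaPDFReal a r x * x ^ k =
      Real.Gamma (a + k) / (Real.Gamma a * r ^ k) * gammaPDFReal (a + k) r x := by
  have := Real.Gamma_pos_of_pos ha
  have : 0 < Real.Gamma (a + k) := Real.Gamma_pos_of_pos (by positivity)
  rcases hx.lt_or_gt with hneg | hpos
  · simp [gammaPDFReal, hneg.not_ge]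
  · rw [gammaPDFReal, gammaPDFReal, if_pos hpos.le, if_pos hpos.le, add_sub_right_comm,
      Real.rpow_add_natCast hpos.ne', Real.rpow_add_natCast hr.ne']
    field_simp

lemma integrable_pow_gammaMeasure (ha : 0 < a) (hr : 0 < r) (k : ℕ) :
    Integrable (fun x => x ^ k) (gammaMeasure a r) := by
  rw [gammaMeasure, integrable_withDensity_iff (measurable_gammaPDF a r)
    (Filter.Eventually.of_forall fun _ => ENNReal.ofReal_lt_top)]
  refine ((integrable_gammaPDFReal (a := a + k) (by positivity) hr).const_mul
    (Real.Gamma (a + k) / (Real.Gamma a * r ^ k))).congr ?_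
  filter_upwards [Measure.ae_ne volume (0 : ℝ)] with x hx
  rw [← gammaPDFReal_mul_pow ha hr k hx, gammaPDF, ENNReal.toReal_ofReal
    (gammaPDFReal_nonneg ha hr x), mul_comm]

lemma integral_pow_gammaMeasure (ha : 0 < a) (hr : 0 < r) (k : ℕ) :
    ∫ x, x ^ k ∂gammaMeasure a r = Real.Gamma (a + k) / (Real.Gamma a * r ^ k) := by
  calc ∫ x, x ^ k ∂gammaMeasure a r
      = ∫ x, (gammaPDF a r x).toReal * x ^ k :=
        integral_withDensity_eq_integral_toReal_smul (measurable_gammaPDF a r)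
          (Filter.Eventually.of_forall fun _ => ENNReal.ofReal_lt_top) _
    _ = ∫ x, Real.Gamma (a + k) / (Real.Gamma a * r ^ k) * gammaPDFReal (a + k) r x := by
        refine integral_congr_ae ?_
        filter_upwards [Measure.ae_ne volume (0 : ℝ)] with x hx
        rw [gammaPDF, ENNReal.toReal_ofReal (gammaPDFReal_nonneg ha hr x),
          gammaPDFReal_mul_pow ha hr k hx]
    _ = Real.Gamma (a + k) / (Real.Gamma a * r ^ k) := by
        rw [integral_const_mul, integral_gammaPDFReal (by positivity) hr, mul_one]

lemma integral_id_gammaMeasure (ha : 0 < a) (hr : 0 < r) :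
    ∫ x, x ∂gammaMeasure a r = a / r := by
  have := Real.Gamma_pos_of_pos ha
  have hmoment := integral_pow_gammaMeasure ha hr 1
  simp only [pow_one, Nat.cast_one, Real.Gamma_add_one ha.ne'] at hmoment
  rw [hmoment]
  field_simp

lemma memLp_id_gammaMeasure (ha : 0 < a) (hr : 0 < r) (k : ℕ) :
    MemLp (fun x => x) k (gammaMeasure a r) := by
  rcases eq_or_ne k 0 with rfl | hk
  · exact Nat.cast_zero (R := ENNReal) ▸ memLp_zero_iff_aestronglyMeasurable.2
      aestronglyMeasurable_id
  · rw [← integrable_norm_rpow_iff (by fun_prop) (by exact_mod_cast hk) (by simp)]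
    simpa using (integrable_pow_gammaMeasure ha hr k).abs

lemma variance_id_gammaMeasure (ha : 0 < a) (hr : 0 < r) :
    Var[fun x => x; gammaMeasure a r] = a / r ^ 2 := by
  have := isProbabilityMeasure_gammaMeasure ha hr
  have := Real.Gamma_pos_of_pos ha
  have hmoment := integral_pow_gammaMeasure ha hr 2
  have hΓ_two : Real.Gamma (a + 2) = (a + 1) * (a * Real.Gamma a) := by
    rw [← Real.Gamma_add_one ha.ne', ← Real.Gamma_add_one (by positivity)]
    ring_nf
  rw [variance_eq_sub (memLp_id_gammaMeasure ha hr 2)]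
  simp only [Pi.pow_apply]
  rw [hmoment, integral_id_gammaMeasure ha hr, Nat.cast_ofNat, hΓ_two]
  field_simp
  ring

end GammaMoments

section ProductLaw

variable {ι 𝓧 : Type*} [Fintype ι] [MeasurableSpace 𝓧] {μ : Measure 𝓧} [IsProbabilityMeasure μ]
  {g : 𝓧 → ℝ}

lemma memLp_sum_comp_eval_pi {p : ENNReal} (hg : MemLp g p μ) :
    MemLp (fun x : ι → 𝓧 => ∑ i, g (x i)) p (Measure.pi fun _ => μ) :=
  memLp_finsetSum _ fun i _ => hg.comp_measurePreserving (measurePreserving_eval (fun _ => μ) i)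

lemma integral_sum_comp_eval_pi (hg : Integrable g μ) :
    ∫ x : ι → 𝓧, ∑ i, g (x i) ∂(Measure.pi fun _ => μ) = Fintype.card ι * ∫ x, g x ∂μ := by
  rw [integral_finsetSum _ fun i _ => integrable_comp_eval (μ := fun _ => μ) hg]
  simp [integral_comp_eval (μ := fun _ : ι => μ) hg.aestronglyMeasurable]

lemma integral_sq_sum_comp_eval_pi (hg : MemLp g 2 μ) (hmean : ∫ x, g x ∂μ = 0) :
    ∫ x : ι → 𝓧, (∑ i, g (x i)) ^ 2 ∂(Measure.pi fun _ => μ) =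
      Fintype.card ι * ∫ x, g x ^ 2 ∂μ := by
  have hsum_mean : ∫ x : ι → 𝓧, ∑ i, g (x i) ∂(Measure.pi fun _ => μ) = 0 := by
    rw [integral_sum_comp_eval_pi (hg.integrable one_le_two), hmean, mul_zero]
  have hvariance := variance_sum_pi (μ := fun _ : ι => μ) (X := fun _ => g) fun _ => hg
  rw [← variance_of_integral_eq_zero
      (memLp_sum_comp_eval_pi hg).aestronglyMeasurable.aemeasurable hsum_mean,
    ← variance_of_integral_eq_zero hg.aestronglyMeasurable.aemeasurable hmean]
  simpa [Finset.sum_fn] using hvariance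

end ProductLaw

section ExpModelLaw

variable {n : ℕ} {θ : ℝ}

lemma expModel_f_of_pos (θ : ℝ) {x : ℝ} (hx : 0 < x) :
    expModel.f θ x = 1 / θ * Real.exp (-(1 / θ) * x) := if_pos hx

lemma expModel_f_of_nonpos (θ : ℝ) {x : ℝ} (hx : x ≤ 0) : expModel.f θ x = 0 :=
  if_neg hx.not_gt

lemma expModel_f_pos {x : ℝ} (hθ : 0 < θ) (hx : 0 < x) : 0 < expModel.f θ x := by
  rw [expModel_f_of_pos θ hx]
  positivity

lemma mem_sampleSupport_expModel {x : Fin n → ℝ} :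
    x ∈ expModel.sampleSupport n ↔ ∀ i, 0 < x i := by
  refine forall_congr' fun i => ⟨fun ⟨θ, _, hf⟩ => ?_, fun hx =>
    ⟨1, Set.mem_Ioi.2 one_pos, expModel_f_pos one_pos hx⟩⟩
  by_contra! hx
  exact hf.ne' (expModel_f_of_nonpos θ hx)

lemma law_expModel (θ : ℝ) : expModel.law θ = expMeasure (1 / θ) := by
  rw [ParamModel.law, expMeasure, gammaMeasure]
  refine withDensity_congr_ae ?_
  filter_upwards [Measure.ae_ne volume (0 : ℝ)] with x hx
  rcases hx.lt_or_gt with hneg | hpos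
  · rw [gammaPDF_of_neg hneg, expModel_f_of_nonpos θ hneg.le, ENNReal.ofReal_zero]
  · rw [gammaPDF_of_nonneg hpos.le, expModel_f_of_pos θ hpos]
    simp

lemma isProbabilityMeasure_law_expModel (hθ : 0 < θ) : IsProbabilityMeasure (expModel.law θ) := by
  rw [law_expModel]
  exact isProbabilityMeasure_expMeasure (by positivity)

lemma isProbabilityMeasure_sampleLaw_expModel (n : ℕ) (hθ : 0 < θ) :
    IsProbabilityMeasure (expModel.sampleLaw n θ) := by
  have := isProbabilityMeasure_law_expModel hθ
  rw [ParamModel.sampleLaw]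
  infer_instance

lemma measurable_expModel_f (θ : ℝ) : Measurable (expModel.f θ) :=
  Measurable.ite measurableSet_Ioi (by fun_prop) measurable_const

lemma ae_law_expModel_pos (θ : ℝ) : ∀ᵐ x ∂expModel.law θ, 0 < x := by
  rw [ParamModel.law, ae_withDensity_iff (measurable_expModel_f θ).ennreal_ofReal]
  refine Filter.Eventually.of_forall fun x hf => ?_
  by_contra! hx
  exact hf (by rw [expModel_f_of_nonpos θ hx, ENNReal.ofReal_zero])

lemma ae_sampleLaw_expModel_pos (n : ℕ) (hθ : 0 < θ) :
    ∀ᵐ x ∂expModel.sampleLaw n θ, ∀ i, 0 < x i := by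
  have := isProbabilityMeasure_law_expModel hθ
  exact ae_all_iff.2 fun i =>
    (measurePreserving_eval (fun _ : Fin n => expModel.law θ) i).quasiMeasurePreserving.ae
      (ae_law_expModel_pos θ)

lemma law_expModel_Ioo_pos {a b : ℝ} (hθ : 0 < θ) (ha : 0 ≤ a) (hab : a < b) :
    0 < expModel.law θ (Set.Ioo a b) := by
  rw [ParamModel.law, withDensity_apply _ measurableSet_Ioo,
    setLIntegral_pos_iff (measurable_expModel_f θ).ennreal_ofReal]
  refine (Measure.measure_Ioo_pos (μ := volume).2 hab).trans_le (measure_mono fun x hx => ?_)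
  exact ⟨(ENNReal.ofReal_pos.2 (expModel_f_pos hθ (ha.trans_lt hx.1))).ne', hx⟩

lemma memLp_id_law_expModel (hθ : 0 < θ) (k : ℕ) : MemLp (fun x => x) k (expModel.law θ) := by
  rw [law_expModel]
  exact memLp_id_gammaMeasure one_pos (one_div_pos.2 hθ) k

lemma integral_id_law_expModel (hθ : 0 < θ) : ∫ x, x ∂expModel.law θ = θ := by
  rw [law_expModel, expMeasure, integral_id_gammaMeasure one_pos (one_div_pos.2 hθ),
    one_div_one_div]

lemma variance_id_law_expModel (hθ : 0 < θ) : Var[fun x => x; expModel.law θ] = θ ^ 2 := by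
  rw [law_expModel, expMeasure, variance_id_gammaMeasure one_pos (one_div_pos.2 hθ)]
  field_simp

end ExpModelLaw

section ExpModelLikelihood

variable {n : ℕ} {θ : ℝ} {x : Fin n → ℝ}

lemma log_expModel_f {y : ℝ} (hθ : 0 < θ) (hy : 0 < y) :
    Real.log (expModel.f θ y) = -Real.log θ - y / θ := by
  rw [expModel_f_of_pos θ hy, Real.log_mul (by positivity) (Real.exp_ne_zero _), Real.log_exp,
    one_div, Real.log_inv]
  ring

lemma lik_expModel_pos (hx : ∀ i, 0 < x i) (hθ : 0 < θ) : 0 < expModel.lik θ x :=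
  Finset.prod_pos fun i _ => expModel_f_pos hθ (hx i)

lemma loglik_expModel (hx : ∀ i, 0 < x i) (hθ : 0 < θ) :
    expModel.loglik θ x = -(n * Real.log θ) - (∑ i, x i) / θ := by
  rw [ParamModel.loglik, ParamModel.lik, Real.log_prod fun i _ => (expModel_f_pos hθ (hx i)).ne']
  simp_rw [log_expModel_f hθ (hx _)]
  simp [Finset.sum_sub_distrib, Finset.sum_div]

lemma sum_eq_mul_sampleMean (hn : n ≠ 0) (x : Fin n → ℝ) : ∑ i, x i = n * sampleMean x := by
  rw [sampleMean]
  field_simp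

lemma sampleMean_pos (hn : n ≠ 0) (hx : ∀ i, 0 < x i) : 0 < sampleMean x := by
  have := NeZero.mk hn
  exact div_pos (Finset.sum_pos (fun i _ => hx i) Finset.univ_nonempty) (by positivity)

lemma loglik_sampleMean_sub (hn : n ≠ 0) (hx : ∀ i, 0 < x i) (hθ : 0 < θ) :
    expModel.loglik (sampleMean x) x - expModel.loglik θ x =
      n * deviance (Real.log (sampleMean x / θ)) := by
  have hmean := sampleMean_pos hn hx
  rw [loglik_expModel hx hmean, loglik_expModel hx hθ, deviance, Real.exp_log (div_pos hmean hθ),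
    Real.log_div hmean.ne' hθ.ne', sum_eq_mul_sampleMean hn]
  field_simp
  ring

lemma isMLE_expModel_iff (hn : n ≠ 0) (hx : ∀ i, 0 < x i) (θ : ℝ) :
    expModel.IsMLE x θ ↔ θ = sampleMean x := by
  have hmean := sampleMean_pos hn hx
  constructor
  · rintro ⟨hθ : 0 < θ, hmax⟩
    by_contra hne
    have hlog : Real.log (sampleMean x / θ) ≠ 0 :=
      Real.log_ne_zero_of_pos_of_ne_one (div_pos hmean hθ) fun heq =>
        hne ((div_eq_one_iff_eq hθ.ne').1 heq).symm
    have hgap : 0 < n * deviance (Real.log (sampleMean x / θ)) :=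
      mul_pos (by positivity) (deviance_pos hlog)
    rw [← loglik_sampleMean_sub hn hx hθ, sub_pos] at hgap
    exact hgap.not_ge (Real.log_le_log (lik_expModel_pos hx hmean) (hmax _ hmean))
  · rintro rfl
    refine ⟨hmean, fun θ (hθ : 0 < θ) => ?_⟩
    have hgap : 0 ≤ n * deviance (Real.log (sampleMean x / θ)) :=
      mul_nonneg n.cast_nonneg (deviance_nonneg _)
    rw [← loglik_sampleMean_sub hn hx hθ, sub_nonneg] at hgap
    exact (Real.log_le_log_iff (lik_expModel_pos hx hθ) (lik_expModel_pos hx hmean)).1 hgap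

lemma hasDerivAt_neg_mul_log_sub_div (a s : ℝ) (hθ : θ ≠ 0) :
    HasDerivAt (fun t => -(a * Real.log t) - s / t) ((s - a * θ) / θ ^ 2) θ := by
  refine (((Real.hasDerivAt_log hθ).const_mul a).fun_neg.fun_sub
    ((hasDerivAt_const θ s).fun_div (hasDerivAt_id' θ) hθ)).congr_deriv ?_
  field_simp
  ring

lemma score_expModel {y : ℝ} (hθ : 0 < θ) (hy : 0 < y) :
    expModel.score θ y = (y - θ) / θ ^ 2 := by
  have hlocal : (fun t => Real.log (expModel.f t y)) =ᶠ[nhds θ]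
      fun t => -(1 * Real.log t) - y / t := by
    filter_upwards [Ioi_mem_nhds hθ] with t ht
    rw [log_expModel_f ht hy, one_mul]
  rw [ParamModel.score, hlocal.deriv_eq, (hasDerivAt_neg_mul_log_sub_div 1 y hθ.ne').deriv, one_mul]

lemma deriv_loglik_expModel (hx : ∀ i, 0 < x i) (hθ : 0 < θ) :
    deriv (fun t => expModel.loglik t x) θ = (∑ i, x i - n * θ) / θ ^ 2 := by
  have hlocal : (fun t => expModel.loglik t x) =ᶠ[nhds θ]
      fun t => -(n * Real.log t) - (∑ i, x i) / t := by
    filter_upwards [Ioi_mem_nhds hθ] with t ht using loglik_expModel hx ht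
  rw [hlocal.deriv_eq, (hasDerivAt_neg_mul_log_sub_div n _ hθ.ne').deriv]

lemma iteratedDeriv_two_loglik_expModel (hx : ∀ i, 0 < x i) (hθ : 0 < θ) :
    iteratedDeriv 2 (fun t => expModel.loglik t x) θ = (n * θ - 2 * ∑ i, x i) / θ ^ 3 := by
  have hlocal : deriv (fun t => expModel.loglik t x) =ᶠ[nhds θ]
      fun t => (∑ i, x i - n * t) / t ^ 2 := by
    filter_upwards [Ioi_mem_nhds hθ] with t ht using deriv_loglik_expModel hx ht
  have hderiv : HasDerivAt (fun t : ℝ => (∑ i, x i - n * t) / t ^ 2)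
      ((n * θ - 2 * ∑ i, x i) / θ ^ 3) θ := by
    refine (((hasDerivAt_const θ (∑ i, x i)).fun_sub ((hasDerivAt_id' θ).const_mul (n : ℝ))).fun_div
      (hasDerivAt_pow 2 θ) (by positivity)).congr_deriv ?_
    simp only [Nat.cast_ofNat]
    field_simp
    ring
  rw [iteratedDeriv_succ, iteratedDeriv_one, hlocal.deriv_eq, hderiv.deriv]

lemma iteratedDeriv_three_loglik_expModel (hx : ∀ i, 0 < x i) (hθ : 0 < θ) :
    iteratedDeriv 3 (fun t => expModel.loglik t x) θ = (6 * ∑ i, x i - 2 * n * θ) / θ ^ 4 := by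
  have hlocal : iteratedDeriv 2 (fun t => expModel.loglik t x) =ᶠ[nhds θ]
      fun t => (n * t - 2 * ∑ i, x i) / t ^ 3 := by
    filter_upwards [Ioi_mem_nhds hθ] with t ht using iteratedDeriv_two_loglik_expModel hx ht
  have hderiv : HasDerivAt (fun t : ℝ => (n * t - 2 * ∑ i, x i) / t ^ 3)
      ((6 * ∑ i, x i - 2 * n * θ) / θ ^ 4) θ := by
    refine ((((hasDerivAt_id' θ).const_mul (n : ℝ)).fun_sub
      (hasDerivAt_const θ (2 * ∑ i, x i))).fun_div
      (hasDerivAt_pow 3 θ) (by positivity)).congr_deriv ?_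
    simp only [Nat.cast_ofNat]
    field_simp
    ring
  rw [iteratedDeriv_succ, hlocal.deriv_eq, hderiv.deriv]

end ExpModelLikelihood

section ExpModelRegularity

variable {n : ℕ} {θ : ℝ}

lemma score_expModel_ae (hθ : 0 < θ) :
    expModel.score θ =ᵐ[expModel.law θ] fun y => (y - θ) / θ ^ 2 := by
  filter_upwards [ae_law_expModel_pos θ] with y hy using score_expModel hθ hy

lemma memLp_score_expModel (hθ : 0 < θ) (k : ℕ) : MemLp (expModel.score θ) k (expModel.law θ) := by
  have := isProbabilityMeasure_law_expModel hθ
  refine MemLp.ae_eq (score_expModel_ae hθ).symm ?_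
  simpa only [div_eq_mul_inv, Pi.sub_apply] using
    ((memLp_id_law_expModel hθ k).sub (memLp_const θ)).mul_const (θ ^ 2)⁻¹

lemma integral_score_expModel (hθ : 0 < θ) : ∫ y, expModel.score θ y ∂expModel.law θ = 0 := by
  have := isProbabilityMeasure_law_expModel hθ
  have hintegrable := (memLp_id_law_expModel hθ 1).integrable (by simp)
  rw [integral_congr_ae (score_expModel_ae hθ), integral_div,
    integral_sub hintegrable (integrable_const θ), integral_id_law_expModel hθ]
  simp

lemma fisherInfo_expModel (hθ : 0 < θ) : expModel.fisherInfo θ = 1 / θ ^ 2 := by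
  have hscore : (fun y => expModel.score θ y ^ 2) =ᵐ[expModel.law θ]
      fun y => (y - θ) ^ 2 / θ ^ 4 := by
    filter_upwards [score_expModel_ae hθ] with y hy
    rw [hy, div_pow]
    ring
  have hvariance : ∫ y, (y - θ) ^ 2 ∂expModel.law θ = θ ^ 2 := by
    rw [← variance_id_law_expModel hθ, variance_eq_integral (by fun_prop),
      integral_id_law_expModel hθ]
  rw [ParamModel.fisherInfo, integral_congr_ae hscore, integral_div, hvariance]
  field_simp

lemma deriv_loglik_expModel_ae (n : ℕ) (hθ : 0 < θ) :
    (fun x => deriv (fun t => expModel.loglik t x) θ) =ᵐ[expModel.sampleLaw n θ]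
      fun x => ∑ i, expModel.score θ (x i) := by
  filter_upwards [ae_sampleLaw_expModel_pos n hθ] with x hx
  rw [deriv_loglik_expModel hx hθ, Finset.sum_congr rfl fun i _ => score_expModel hθ (hx i),
    ← Finset.sum_div, Finset.sum_sub_distrib]
  simp

lemma memLp_sum_sampleLaw_expModel (n : ℕ) (hθ : 0 < θ) (k : ℕ) :
    MemLp (fun x => ∑ i, x i) k (expModel.sampleLaw n θ) := by
  have := isProbabilityMeasure_law_expModel hθ
  exact memLp_sum_comp_eval_pi (memLp_id_law_expModel hθ k)

lemma integral_sum_sampleLaw_expModel (n : ℕ) (hθ : 0 < θ) :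
    ∫ x, ∑ i, x i ∂expModel.sampleLaw n θ = n * θ := by
  have := isProbabilityMeasure_law_expModel hθ
  have hintegrable := (memLp_id_law_expModel hθ 1).integrable (by simp)
  have hsum := integral_sum_comp_eval_pi (ι := Fin n) hintegrable
  rwa [Fintype.card_fin, integral_id_law_expModel hθ] at hsum

lemma rc1_expModel : expModel.RC1 := by
  intro θ (hθ : 0 < θ) θ' (hθ' : 0 < θ') hne hdensity
  have hlaw : expModel.law θ = expModel.law θ' :=
    withDensity_congr_ae (hdensity.fun_comp ENNReal.ofReal)
  exact hne (by rw [← integral_id_law_expModel hθ, hlaw, integral_id_law_expModel hθ'])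

lemma rc2_expModel (n : ℕ) : expModel.RC2 n := by
  refine ⟨isOpen_Ioi, fun x hx => ?_⟩
  have hsmooth : ContDiffOn ℝ 3 (fun θ : ℝ => -(n * Real.log θ) - (∑ i, x i) / θ) (Set.Ioi 0) := by
    intro θ (hθ : 0 < θ)
    exact ((contDiffAt_const.mul (Real.contDiffAt_log.2 hθ.ne')).neg.sub
      (contDiffAt_const.div contDiffAt_id hθ.ne')).contDiffWithinAt
  exact hsmooth.congr fun θ hθ => loglik_expModel (mem_sampleSupport_expModel.1 hx) hθ

/-- The function `M` of (R.C.3) for the neighbourhood `(θ₀ / 2, 3 θ₀ / 2)` of `θ₀`, obtained from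
`∂³ℓ/∂θ³ = (6 ∑ xᵢ - 2 n θ) / θ⁴`. -/
noncomputable def thirdDerivMajorant (n : ℕ) (θ₀ : ℝ) (x : Fin n → ℝ) : ℝ :=
  (6 * ∑ i, x i + 3 * n * θ₀) / (θ₀ / 2) ^ 4

lemma abs_iteratedDeriv_three_loglik_le_thirdDerivMajorant {x : Fin n → ℝ} (hx : ∀ i, 0 < x i)
    {θ₀ : ℝ} (hθ₀ : 0 < θ₀) (hθ : |θ - θ₀| < θ₀ / 2) :
    |iteratedDeriv 3 (fun t => expModel.loglik t x) θ| ≤ thirdDerivMajorant n θ₀ x := by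
  obtain ⟨hlower, hupper⟩ := abs_lt.1 hθ
  have hhalf : θ₀ / 2 ≤ θ := by linarith
  have hpos : 0 < θ := by linarith
  have hsum : 0 ≤ ∑ i, x i := Finset.sum_nonneg fun i _ => (hx i).le
  have hnum : |6 * ∑ i, x i - 2 * n * θ| ≤ 6 * ∑ i, x i + 3 * n * θ₀ := by
    have hnθ : n * (2 * θ) ≤ n * (3 * θ₀) := mul_le_mul_of_nonneg_left (by linarith) n.cast_nonneg
    have hnθ0 : 0 ≤ n * θ := by positivity
    rw [abs_le]
    constructor <;> linarith
  rw [iteratedDeriv_three_loglik_expModel hx hpos, thirdDerivMajorant, abs_div,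
    abs_of_pos (pow_pos hpos 4)]
  gcongr

lemma memLp_thirdDerivMajorant (n : ℕ) {θ₀ : ℝ} (hθ₀ : 0 < θ₀) (k : ℕ) :
    MemLp (thirdDerivMajorant n θ₀) k (expModel.sampleLaw n θ₀) := by
  have := isProbabilityMeasure_sampleLaw_expModel n hθ₀
  unfold thirdDerivMajorant
  simpa only [div_eq_mul_inv, Pi.add_apply] using
    (((memLp_sum_sampleLaw_expModel n hθ₀ k).const_mul 6).add
      (memLp_const (3 * n * θ₀))).mul_const ((θ₀ / 2) ^ 4)⁻¹

lemma thirdDerivBound_expModel (n : ℕ) {θ₀ : ℝ} (hθ₀ : 0 < θ₀) :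
    expModel.ThirdDerivBound n θ₀ (θ₀ / 2) (thirdDerivMajorant n θ₀) := by
  have := isProbabilityMeasure_sampleLaw_expModel n hθ₀
  refine ⟨half_pos hθ₀, fun θ hθ => ⟨?_, fun x hx => ?_⟩, ?_⟩
  · exact Set.mem_Ioi.2 (by linarith [(abs_lt.1 hθ).1])
  · exact abs_iteratedDeriv_three_loglik_le_thirdDerivMajorant (mem_sampleSupport_expModel.1 hx)
      hθ₀ hθ
  · exact (memLp_thirdDerivMajorant n hθ₀ 1).integrable (by simp)

lemma rc3_expModel (n : ℕ) : expModel.RC3 n :=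
  fun _ hθ₀ => ⟨_, _, thirdDerivBound_expModel n hθ₀⟩

lemma rc4_expModel : expModel.RC4 := by
  intro θ (hθ : 0 < θ)
  have := isProbabilityMeasure_law_expModel hθ
  exact ⟨(memLp_score_expModel hθ 1).integrable (by simp), integral_score_expModel hθ⟩

lemma integral_sq_deriv_loglik_expModel (n : ℕ) (hθ : 0 < θ) :
    ∫ x, deriv (fun t => expModel.loglik t x) θ ^ 2 ∂expModel.sampleLaw n θ =
      n * expModel.fisherInfo θ := by
  have := isProbabilityMeasure_law_expModel hθ
  have hsq := integral_sq_sum_comp_eval_pi (ι := Fin n) (memLp_score_expModel hθ 2)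
    (integral_score_expModel hθ)
  rw [Fintype.card_fin] at hsq
  exact (integral_congr_ae ((deriv_loglik_expModel_ae n hθ).fun_comp (· ^ 2))).trans hsq

lemma integrable_sq_deriv_loglik_expModel (n : ℕ) (hθ : 0 < θ) :
    Integrable (fun x => deriv (fun t => expModel.loglik t x) θ ^ 2) (expModel.sampleLaw n θ) := by
  have := isProbabilityMeasure_law_expModel hθ
  have hsum : MemLp (fun x : Fin n → ℝ => ∑ i, expModel.score θ (x i)) 2
      (expModel.sampleLaw n θ) := memLp_sum_comp_eval_pi (memLp_score_expModel hθ 2)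
  exact (hsum.ae_eq (deriv_loglik_expModel_ae n hθ).symm).integrable_sq

lemma iteratedDeriv_two_loglik_expModel_ae (n : ℕ) (hθ : 0 < θ) :
    (fun x => iteratedDeriv 2 (fun t => expModel.loglik t x) θ) =ᵐ[expModel.sampleLaw n θ]
      fun x => (n * θ - 2 * ∑ i, x i) / θ ^ 3 := by
  filter_upwards [ae_sampleLaw_expModel_pos n hθ] with x hx
  exact iteratedDeriv_two_loglik_expModel hx hθ

lemma integrable_iteratedDeriv_two_loglik_expModel (n : ℕ) (hθ : 0 < θ) :
    Integrable (fun x => iteratedDeriv 2 (fun t => expModel.loglik t x) θ)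
      (expModel.sampleLaw n θ) := by
  have := isProbabilityMeasure_sampleLaw_expModel n hθ
  have hsum := (memLp_sum_sampleLaw_expModel n hθ 1).integrable (by simp)
  exact (((integrable_const _).sub (hsum.const_mul 2)).div_const _).congr
    (iteratedDeriv_two_loglik_expModel_ae n hθ).symm

lemma integral_iteratedDeriv_two_loglik_expModel (n : ℕ) (hθ : 0 < θ) :
    ∫ x, iteratedDeriv 2 (fun t => expModel.loglik t x) θ ∂expModel.sampleLaw n θ =
      -(n * expModel.fisherInfo θ) := by
  have := isProbabilityMeasure_sampleLaw_expModel n hθ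
  have hsum := (memLp_sum_sampleLaw_expModel n hθ 1).integrable (by simp)
  rw [integral_congr_ae (iteratedDeriv_two_loglik_expModel_ae n hθ), integral_div,
    integral_sub (integrable_const _) (hsum.const_mul 2),
    integral_const_mul 2 fun x : Fin n → ℝ => ∑ i, x i, integral_sum_sampleLaw_expModel n hθ,
    fisherInfo_expModel hθ]
  simp only [integral_const, probReal_univ, one_smul]
  field_simp
  ring

lemma rc5_expModel (n : ℕ) : expModel.RC5 n := by
  intro θ (hθ : 0 < θ)
  refine ⟨(memLp_score_expModel hθ 2).integrable_sq, ?_, integrable_sq_deriv_loglik_expModel n hθ,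
    (integral_sq_deriv_loglik_expModel n hθ).symm,
    integrable_iteratedDeriv_two_loglik_expModel n hθ, ?_⟩
  · rw [fisherInfo_expModel hθ]
    positivity
  · rw [integral_iteratedDeriv_two_loglik_expModel n hθ, neg_neg]

lemma abs_sampleMean_sub_lt {x : Fin n → ℝ} {ε : ℝ} (hn : n ≠ 0) (hx : ∀ i, |x i - θ| < ε) :
    |sampleMean x - θ| < ε := by
  have := NeZero.mk hn
  have hsum : |∑ i, (x i - θ)| < n * ε := by
    refine (Finset.abs_sum_le_sum_abs _ _).trans_lt ?_
    simpa using Finset.sum_lt_sum_of_nonempty Finset.univ_nonempty fun i _ => hx i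
  rw [Finset.sum_sub_distrib, sum_eq_mul_sampleMean hn, Finset.sum_const, Finset.card_univ,
    Fintype.card_fin, nsmul_eq_mul, ← mul_sub, abs_mul, Nat.abs_cast] at hsum
  exact lt_of_mul_lt_mul_left hsum n.cast_nonneg

lemma sampleLaw_expModel_abs_sampleMean_sub_lt_pos (hn : n ≠ 0) (hθ : 0 < θ) {ε : ℝ}
    (hε : 0 < ε) : 0 < expModel.sampleLaw n θ {x | |sampleMean x - θ| < ε} := by
  have := isProbabilityMeasure_law_expModel hθ
  have hbox : Set.univ.pi (fun _ : Fin n => Set.Ioo θ (θ + ε)) ⊆ {x | |sampleMean x - θ| < ε} := by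
    refine fun x hx => abs_sampleMean_sub_lt hn fun i => abs_lt.2 ?_
    obtain ⟨hlower, hupper⟩ := hx i trivial
    constructor <;> linarith
  refine lt_of_lt_of_le ?_ (measure_mono hbox)
  rw [ParamModel.sampleLaw, Measure.pi_pi, pos_iff_ne_zero, Finset.prod_ne_zero_iff]
  exact fun i _ => (law_expModel_Ioo_pos hθ hθ.le (lt_add_of_pos_right θ hε)).ne'

lemma integrable_cond_of_integrable {α E : Type*} [MeasurableSpace α] [NormedAddCommGroup E]
    {μ : Measure α} {s : Set α} {f : α → E} (hf : Integrable f μ) (hs : μ s ≠ 0) :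
    Integrable f (ProbabilityTheory.cond μ s) :=
  hf.restrict.smul_measure (ENNReal.inv_ne_top.2 hs)

lemma o2_expModel (hn : n ≠ 0) : expModel.O2 n sampleMean := by
  intro θ₀ (hθ₀ : 0 < θ₀)
  refine ⟨_, _, thirdDerivBound_expModel n hθ₀, fun ε hε _ => ?_⟩
  have hpos := sampleLaw_expModel_abs_sampleMean_sub_lt_pos hn hθ₀ hε
  refine ⟨hpos, fun κ hκ => integrable_cond_of_integrable ?_ hpos.ne'⟩
  have hM := memLp_thirdDerivMajorant n hθ₀ κ
  have heven : Even κ := by rcases hκ with rfl | rfl <;> decide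
  have := isProbabilityMeasure_sampleLaw_expModel n hθ₀
  simpa only [Real.norm_eq_abs, heven.pow_abs] using hM.integrable_norm_pow'

lemma o3_expModel : expModel.O3 := by
  intro θ (hθ : 0 < θ) k _
  have := isProbabilityMeasure_law_expModel hθ
  exact (memLp_score_expModel hθ k).integrable_norm_pow'

end ExpModelRegularity

section SupNorm

variable {g h : ℝ → ℝ}

lemma abs_le_supNorm (hg : ∃ C, ∀ x, |g x| ≤ C) (x : ℝ) : |g x| ≤ supNorm g := by
  obtain ⟨C, hC⟩ := hg
  exact le_ciSup (f := fun y => |g y|) ⟨C, Set.forall_mem_range.2 hC⟩ x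

lemma supNorm_nonneg (g : ℝ → ℝ) : 0 ≤ supNorm g := Real.iSup_nonneg fun _ => abs_nonneg _

lemma supNorm_pos (hg : ∃ C, ∀ x, |g x| ≤ C) (hne : g ≠ 0) : 0 < supNorm g := by
  obtain ⟨x, hx⟩ := Function.ne_iff.1 hne
  exact (abs_pos.2 hx).trans_le (abs_le_supNorm hg x)

lemma abs_sub_le_supNorm_deriv_mul (hh : Differentiable ℝ h) (hderiv : ∃ C, ∀ x, |deriv h x| ≤ C)
    (s t : ℝ) : |h t - h s| ≤ supNorm (deriv h) * |t - s| :=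
  convex_univ.norm_image_sub_le_of_norm_deriv_le (fun x _ => hh x)
    (fun x _ => abs_le_supNorm hderiv x) (Set.mem_univ s) (Set.mem_univ t)

lemma IsCb2.abs_sub_zero_le (hh : IsCb2 h) (t : ℝ) (ht : 0 ≤ t) :
    |h t - h 0| ≤ supNorm (deriv h) * t := by
  simpa [abs_of_nonneg ht] using
    abs_sub_le_supNorm_deriv_mul (hh.contDiff.differentiable two_ne_zero) hh.bdd_deriv 0 t

end SupNorm

section Constants

lemma scoreTerm_pos {θ₀ : ℝ} (hθ₀ : 0 < θ₀) (n : ℕ) : 0 < scoreTerm θ₀ n := by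
  have := Real.pi_pos
  unfold scoreTerm
  positivity

lemma three_le_remainderTerm (n : ℕ) : 3 ≤ remainderTerm n := by
  have hfirst : 1 ≤ √(3 + 6 / (n : ℝ)) := by
    rw [Real.one_le_sqrt]
    linarith [show (0 : ℝ) ≤ 6 / n by positivity]
  calc (3 : ℝ) ≤ 6 * √(3 + 6 / (n : ℝ)) := by linarith
    _ ≤ remainderTerm n := by
      rw [remainderTerm, add_assoc]
      exact le_add_of_nonneg_right (by positivity)

lemma three_mul_div_le_div_mul_remainderTerm (n : ℕ) {D : ℝ} (hD : 0 ≤ D) :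
    3 * D / √(n : ℝ) ≤ D / √(n : ℝ) * remainderTerm n := by
  rw [mul_comm 3, mul_div_right_comm]
  exact mul_le_mul_of_nonneg_left (three_le_remainderTerm n) (by positivity)

lemma three_mul_div_lt_add_scoreTerm_add (n : ℕ) {θ₀ B D : ℝ} (hθ₀ : 0 < θ₀) (hB : 0 ≤ B)
    (hD : 0 ≤ D) :
    3 * D / √(n : ℝ) < 8 * B / n + scoreTerm θ₀ n + D / √(n : ℝ) * remainderTerm n := by
  have hscore := scoreTerm_pos hθ₀ n
  have hbound : 0 ≤ 8 * B / n := by positivity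
  linarith [three_mul_div_le_div_mul_remainderTerm n hD]

lemma three_mul_div_lt_add_mul_scoreTerm_add {n : ℕ} (hn : n ≠ 0) {θ₀ B D E : ℝ} (hθ₀ : 0 < θ₀)
    (hB : 0 < B) (hD : 0 ≤ D) (hE : 0 ≤ E) :
    3 * D / √(n : ℝ) < 8 * B / n + 2 * (D + E) / √(n : ℝ) * scoreTerm θ₀ n +
      D / √(n : ℝ) * remainderTerm n := by
  have hscore := scoreTerm_pos hθ₀ n
  have hbound : 0 < 8 * B / n := by positivity
  have hmiddle : 0 ≤ 2 * (D + E) / √(n : ℝ) * scoreTerm θ₀ n := by positivity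
  linarith [three_mul_div_le_div_mul_remainderTerm n hD]

end Constants

section LikelihoodRatio

variable {Ω Ω' : Type*} [MeasurableSpace Ω] [MeasurableSpace Ω'] {P : Measure Ω} {P' : Measure Ω'}
  {n : ℕ} {θ₀ : ℝ} {X : Fin n → Ω → ℝ} {K : Ω' → ℝ} {h : ℝ → ℝ}

lemma integral_chiSquaredMeasure_one (hh : Measurable h) :
    ∫ t, h t ∂chiSquaredMeasure 1 = ∫ z, h (z ^ 2) ∂gaussianReal 0 1 := by
  rw [chiSquaredMeasure, integral_map (Measurable.aemeasurable (by fun_prop))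
    hh.aestronglyMeasurable]
  simpa using integral_comp_eval (μ := fun _ : Fin 1 => gaussianReal 0 1) (i := 0)
    (f := fun z => h (z ^ 2)) (hh.comp (measurable_id.pow_const 2)).aestronglyMeasurable

lemma ae_mem_sampleSupport_expModel (hX : ∀ i, HasLaw (X i) (expMeasure (1 / θ₀)) P) :
    ∀ᵐ ω ∂P, (fun i => X i ω) ∈ expModel.sampleSupport n := by
  simp_rw [mem_sampleSupport_expModel, ae_all_iff]
  intro i
  refine ((hX i).ae_iff (p := fun x => 0 < x) measurableSet_Ioi.mem).2 ?_
  exact law_expModel θ₀ ▸ ae_law_expModel_pos θ₀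

lemma integral_two_mul_loglik_sampleMean_sub (hn : n ≠ 0) (hθ₀ : 0 < θ₀)
    (hX : ∀ i, HasLaw (X i) (expMeasure (1 / θ₀)) P) (hind : iIndepFun X P) (hh : Measurable h) :
    ∫ ω, h (2 * (expModel.loglik (sampleMean fun i => X i ω) (fun i => X i ω) -
        expModel.loglik θ₀ (fun i => X i ω))) ∂P =
      ∫ s, h (2 * n * deviance (Real.log (s / (n / (1 / θ₀))))) ∂gammaMeasure n (1 / θ₀) := by
  have := NeZero.mk hn
  have hsum : HasLaw (∑ i, X i) (gammaMeasure n (1 / θ₀)) P := by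
    simpa using hasLaw_sum_gammaMeasure (fun _ : Fin n => one_pos) (one_div_pos.2 hθ₀) hX hind
      Finset.univ_nonempty
  have hmeasurable : Measurable fun s : ℝ =>
      h (2 * n * deviance (Real.log (s / (n / (1 / θ₀))))) := by
    unfold deviance
    fun_prop
  rw [← hsum.integral_comp hmeasurable.aestronglyMeasurable]
  refine integral_congr_ae ?_
  filter_upwards [ae_mem_sampleSupport_expModel hX] with ω hω
  rw [loglik_sampleMean_sub hn (mem_sampleSupport_expModel.1 hω) hθ₀, ← mul_assoc,
    Function.comp_apply, Finset.sum_apply, sampleMean, div_div_eq_mul_div, mul_one_div,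
    div_right_comm]

lemma abs_integral_two_mul_loglik_sampleMean_sub_sub_le (hn : n ≠ 0) (hθ₀ : 0 < θ₀)
    (hX : ∀ i, HasLaw (X i) (expMeasure (1 / θ₀)) P) (hind : iIndepFun X P)
    (hK : HasLaw K (chiSquaredMeasure 1) P') (hh : Measurable h) {L : ℝ}
    (hL : ∀ t, 0 ≤ t → |h t - h 0| ≤ L * t) :
    |(∫ ω, h (2 * (expModel.loglik (sampleMean fun i => X i ω) (fun i => X i ω) -
        expModel.loglik θ₀ (fun i => X i ω))) ∂P) - ∫ ω, h (K ω) ∂P'| ≤ 3 * L / √(n : ℝ) := by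
  have hchi : ∫ ω, h (K ω) ∂P' = ∫ z, h (z ^ 2) ∂gaussianReal 0 1 := by
    rw [← integral_chiSquaredMeasure_one hh]
    exact hK.integral_comp hh.aestronglyMeasurable
  rw [integral_two_mul_loglik_sampleMean_sub hn hθ₀ hX hind hh, hchi]
  exact abs_integral_gammaMeasure_sub_integral_gaussianReal_le hn (one_div_pos.2 hθ₀) hh hL

end LikelihoodRatio

theorem corollary1_general {Ω Ω' : Type*} [MeasurableSpace Ω] [MeasurableSpace Ω']
    (P : Measure Ω) (P' : Measure Ω') (n : ℕ) (hn : 1 ≤ n) (θ₀ : ℝ) (hθ₀ : 0 < θ₀)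
    (X : Fin n → Ω → ℝ) (hX : ∀ i, HasLaw (X i) (expMeasure (1 / θ₀)) P) (hind : iIndepFun X P)
    (K : Ω' → ℝ) (hK : HasLaw K (chiSquaredMeasure 1) P') :
    (∀ x ∈ expModel.sampleSupport n, ∀ θ, expModel.IsMLE x θ ↔ θ = sampleMean x) ∧
    (∀ᵐ ω ∂P, (fun i => X i ω) ∈ expModel.sampleSupport n) ∧
    (expModel.RC1 ∧ expModel.RC2 n ∧ expModel.RC3 n ∧ expModel.RC4 ∧ expModel.RC5 n ∧
      expModel.O2 n sampleMean ∧ expModel.O3) ∧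
    ∀ h : ℝ → ℝ, Measurable h → ∀ L : ℝ, (∀ t, 0 ≤ t → |h t - h 0| ≤ L * t) →
      |(∫ ω, h (2 * (expModel.loglik (sampleMean fun i => X i ω) (fun i => X i ω) -
          expModel.loglik θ₀ (fun i => X i ω))) ∂P) - ∫ ω, h (K ω) ∂P'| ≤ 3 * L / √(n : ℝ) := by
  have hn0 := Nat.one_le_iff_ne_zero.1 hn
  refine ⟨fun x hx => isMLE_expModel_iff hn0 (mem_sampleSupport_expModel.1 hx),
    ae_mem_sampleSupport_expModel hX, ⟨rc1_expModel, rc2_expModel n, rc3_expModel n,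
      rc4_expModel, rc5_expModel n, o2_expModel hn0, o3_expModel⟩, fun h hh L hL => ?_⟩
  exact abs_integral_two_mul_loglik_sampleMean_sub_sub_le hn0 hθ₀ hX hind hK hh hL

theorem corollary1 {Ω Ω' : Type*} [MeasurableSpace Ω] [MeasurableSpace Ω']
    (P : Measure Ω) [IsProbabilityMeasure P] (P' : Measure Ω') [IsProbabilityMeasure P']
    (n : ℕ) (hn : 1 ≤ n) (θ₀ : ℝ) (hθ₀ : 0 < θ₀)
    (X : Fin n → Ω → ℝ) (hX : ∀ i, HasLaw (X i) (expMeasure (1 / θ₀)) P) (hind : iIndepFun X P)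
    (K : Ω' → ℝ) (hK : HasLaw K (chiSquaredMeasure 1) P') :
    -- the MLE exists, is unique and equals the sample mean
    (∀ x ∈ expModel.sampleSupport n, ∀ θ, expModel.IsMLE x θ ↔ θ = sampleMean x) ∧
    (∀ᵐ ω ∂P, (fun i => X i ω) ∈ expModel.sampleSupport n) ∧
    -- the regularity conditions
    (expModel.RC1 ∧ expModel.RC2 n ∧ expModel.RC3 n ∧ expModel.RC4 ∧ expModel.RC5 n ∧
      expModel.O2 n sampleMean ∧ expModel.O3) ∧
    -- the bounds
    ∀ h : ℝ → ℝ, IsCb2 h →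
      |(∫ ω, h (2 * (expModel.loglik (sampleMean fun i => X i ω) (fun i => X i ω) -
          expModel.loglik θ₀ (fun i => X i ω))) ∂P) - ∫ ω, h (K ω) ∂P'| <
        8 * supNorm h / n + scoreTerm θ₀ n + supNorm (deriv h) / √(n : ℝ) * remainderTerm n ∧
      (h ≠ 0 →
      |(∫ ω, h (2 * (expModel.loglik (sampleMean fun i => X i ω) (fun i => X i ω) -
          expModel.loglik θ₀ (fun i => X i ω))) ∂P) - ∫ ω, h (K ω) ∂P'| <
        8 * supNorm h / n +
        2 * (supNorm (deriv h) + supNorm (iteratedDeriv 2 h)) / √(n : ℝ) * scoreTerm θ₀ n +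
        supNorm (deriv h) / √(n : ℝ) * remainderTerm n) := by
  obtain ⟨hMLE, hsupport, hregular, hbound⟩ :=
    corollary1_general P P' n hn θ₀ hθ₀ X hX hind K hK
  refine ⟨hMLE, hsupport, hregular, fun h hh => ?_⟩
  have hΔ := hbound h hh.contDiff.continuous.measurable (supNorm (deriv h)) hh.abs_sub_zero_le
  exact ⟨hΔ.trans_lt (three_mul_div_lt_add_scoreTerm_add n hθ₀ (supNorm_nonneg h)
      (supNorm_nonneg _)),
    fun hne => hΔ.trans_lt (three_mul_div_lt_add_mul_scoreTerm_add
      (Nat.one_le_iff_ne_zero.1 hn) hθ₀ (supNorm_pos hh.bdd hne) (supNorm_nonneg _)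
      (supNorm_nonneg _))⟩
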